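/- Let $k$ be a field, $\mathfrak g$ a Lie algebra over $k$, $\mathfrak h$ an ideal of $\mathfrak g$, $\pi:\mathfrak g\to\mathfrak g/\mathfrak h$ the projection and $M$ a $\mathfrak g$-module. Put $M^{\mathfrak h}=\{m: z\cdot m=0\ \forall z\in\mathfrak h\}$, a $\mathfrak g/\mathfrak h$-module. **Conventions.** For a Lie algebra $\mathfrak l$ and an $\mathfrak l$-module $V$, $H^1(\mathfrak l,V)$ is the space of derivations $\mathfrak l\to V$ modulo the inner derivations $\delta(v):x\mapsto x\cdot v$, and $H^2$, $H^3$ are alternating bilinear (trilinear) cocycles modulo coboundaries in the Chevalley–Eilenberg complex. An extension of $\mathfrak l$ by the module $V$ corresponds to the class of the 2-cocycle $[s(x),s(y)]-s[x,y]$ for a linear section $s$. A crossed extension $0\to V\to\mathfrak m\xrightarrow{\partial}\mathfrak n\to\mathfrak l\to0$ (an exact sequence, $\partial$ a crossed module, inducing the given action of $\mathfrak l$ on $V$) corresponds to the class in $H^3(\mathfrak l,V)$ of the 3-cocycle $$\sigma(x)\cdot f'(y,z)-\sigma(y)\cdot f'(x,z)+\sigma(z)\cdot f'(x,y)-f'([x,y],z)+f'([x,z],y)-f'([y,z],x),$$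 where $\sigma:\mathfrak l\to\mathfrak n$ is a linear section and $f'$ is a bilinear alternating map to $\mathfrak m$ with $\partial f'(x,y)=[\sigma(x),\sigma(y)]-\sigma[x,y]$. The algebra $\mathfrak g$ acts on $\mathrm{Der}(\mathfrak h,M)$ by $({}^xd)(z)=x\cdot d(z)-d[x,z]$; this induces an action of $\mathfrak g/\mathfrak h$ on $H^1(\mathfrak h,M)$. For a 2-cocycle $f$ on $\mathfrak g$ with values in $M$, $M\times_f\mathfrak g$ is $M\times\mathfrak g$ with bracket $[(m,x),(m',x')]=(x\cdot m'-x'\cdot m+f(x,x'),[x,x'])$, and $M\rtimes\mathfrak g=M\times_0\mathfrak g$. A partial splitting of an extension $0\to M\xrightarrow{i}\mathfrak e\xrightarrow{p}\mathfrak g\to0$ is a Lie algebra map $s:\mathfrak h\to\mathfrak e$ with $p\circ s$ the inclusion $\mathfrak h\subseteq\mathfrak g$. **The three maps.** - $\mathrm{tr}:H^1(\mathfrak h,M)^{\mathfrak g/\mathfrak h}\to H^2(\mathfrak g/\mathfrak h,M^{\mathfrak h})$. Given $[d]$ invariant, let $s_d:\mathfrak h\to M\rtimes\mathfrak g$, $s_d(z)=(d(z),z)$,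 and let $I$ be the largest subalgebra of $M\rtimes\mathfrak g$ in which $s_d(\mathfrak h)$ is an ideal. Then $\mathrm{tr}[d]$ is the class of $0\to M^{\mathfrak h}\to I/s_d(\mathfrak h)\to\mathfrak g/\mathfrak h\to0$. - $\rho:H^2(\mathfrak g,M)_1\to H^1(\mathfrak g/\mathfrak h,H^1(\mathfrak h,M))$, where $H^2(\mathfrak g,M)_1=\ker(H^2(\mathfrak g,M)\to H^2(\mathfrak h,M))$. Given the extension $\mathfrak e=M\times_f\mathfrak g$ and a partial splitting $s$ of it, $\rho[f]$ is the class of the derivation $\pi p(e)\mapsto[d_e]$, where $d_e(z)=i^{-1}\big([e,s(z)]-s[p(e),z]\big)$ for $e\in\mathfrak e$, $z\in\mathfrak h$. - $\lambda:H^1(\mathfrak g/\mathfrak h,H^1(\mathfrak h,M))\to H^3(\mathfrak g/\mathfrak h,M^{\mathfrak h})$. Given a derivation $D$, let $\mathfrak p\subseteq\mathrm{Der}(\mathfrak h,M)\rtimes\mathfrak g$ be the subalgebra of all $(d,x)$ with $[d]=D(\pi(x))$; it acts on $M\rtimes\mathfrak h$ by $(d,x)\cdot(m,z)=(x\cdot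 m+d(z),[x,z])$. Then $\lambda[D]$ is the class of the crossed extension $0\to M^{\mathfrak h}\to M\rtimes\mathfrak h\to\mathfrak p\to\mathfrak g/\mathfrak h\to0$ with middle map $(m,z)\mapsto(-\delta(m),z)$. **Claim.** Fix a linear map $\alpha:\mathfrak g/\mathfrak h\to\mathfrak g$ with $\pi\circ\alpha=\mathrm{id}$ and put $f_\alpha(x\wedge y)=[\alpha(x),\alpha(y)]-\alpha[x,y]\in\mathfrak h$. The classes above do not depend on the choices made (the representatives $d$, $f$, $D$ and the partial splitting), and: 1. Let $[d]\in H^1(\mathfrak h,M)^{\mathfrak g/\mathfrak h}$. There is a linear section $s$ of $M\rtimes\mathfrak g\to\mathfrak g$ with values in $I$, and it can be chosen to extend $s_d$. For every linear section $s:\mathfrak g\to I$, $f_s(x\wedge y)=i^{-1}([s(x),s(y)]-s[x,y])$ defines a 2-cocycle on $\mathfrak g$ with values in $M^{\mathfrak h}$, and $\mathrm{tr}[d]$ is represented by the 2-cocycle $F$ with values in $M^{\mathfrak h}$ given by $$F(x\wedge y)=f_s(\alpha(x)\wedge\alpha(y))+i^{-1}\big(s(f_\alpha(x\wedge y))-s_d(f_\alpha(x\wedge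 y))\big),$$ which is $f_s(\alpha(x)\wedge\alpha(y))$ if $s$ extends $s_d$. 2. Let $[d]\in H^1(\mathfrak h,M)^{\mathfrak g/\mathfrak h}$. There is a linear map $\eta:\mathfrak g/\mathfrak h\to M$ with ${}^{\alpha(x)}d=\delta(\eta(x))$ for all $x$. For every such $\eta$, $\mathrm{tr}[d]$ is represented by the 2-cocycle with values in $M^{\mathfrak h}$ $$F(x\wedge y)=\alpha(x)\cdot\eta(y)-\alpha(y)\cdot\eta(x)-\eta[x,y]-d(f_\alpha(x\wedge y)).$$ 3. Let $[f]\in H^2(\mathfrak g,M)_1$. There is a linear map $\gamma:\mathfrak h\to M$ such that $z\mapsto(\gamma(z),z)$ is a partial splitting of $M\times_f\mathfrak g$, that is, $f(z\wedge w)=\gamma[z,w]-z\cdot\gamma(w)+w\cdot\gamma(z)$ for $z,w\in\mathfrak h$. For every such $\gamma$, $\rho[f]$ is represented by the derivation $D:\mathfrak g/\mathfrak h\to H^1(\mathfrak h,M)$, $x\mapsto[D_x]$, where $D_x\in\mathrm{Der}(\mathfrak h,M)$ is $$D_x(z)=f(\alpha(x)\wedge z)+\alpha(x)\cdot\gamma(z)-\gamma[\alpha(x),z].$$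 4. Let $s:H^1(\mathfrak h,M)\to\mathrm{Der}(\mathfrak h,M)$ be a linear section of the projection and $D:\mathfrak g/\mathfrak h\to H^1(\mathfrak h,M)$ a derivation. There is a bilinear alternating map $F:\mathfrak g/\mathfrak h\times\mathfrak g/\mathfrak h\to M$ with $\delta F(x,y)={}^{\alpha(x)}sD(y)-{}^{\alpha(y)}sD(x)-sD[x,y]$. For every such $F$, $\lambda[D]$ is represented by the 3-cocycle with values in $M^{\mathfrak h}$ $$c(x\wedge y\wedge z)=-c'(x\wedge y\wedge z)+sD(x)(f_\alpha(y\wedge z))-sD(y)(f_\alpha(x\wedge z))+sD(z)(f_\alpha(x\wedge y)),$$ $$c'(x\wedge y\wedge z)=\alpha(x)\cdot F(y,z)-\alpha(y)\cdot F(x,z)+\alpha(z)\cdot F(x,y)-F([x,y],z)+F([x,z],y)-F([y,z],x).$$ -/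

import Mathlib

set_option maxSynthPendingDepth 5
set_option linter.unusedSectionVars false
set_option linter.unusedSimpArgs false
set_option linter.checkUnivs false

namespace LieSeq

open LieModule.Cohomology

universe u v w

section Cohomology

variable (k : Type*) [CommRing k] (L : Type*) [LieRing L] [LieAlgebra k L]
variable (V : Type*) [AddCommGroup V] [Module k V] [LieRingModule L V] [LieModule k L V]

/-- The inner derivations `x ↦ x · v`, that is, the 1-coboundaries. -/
abbrev Inn : Submodule k (LieDerivation k L V) := LinearMap.range (LieDerivation.inner k L V)

/-- `H¹(L, V) = Der(L, V) / Inn(L, V)`. -/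
abbrev H1 : Type _ := LieDerivation k L V ⧸ Inn k L V

/-- The 2-coboundaries, as a subspace of the 2-cocycles. -/
abbrev B2 : Submodule k (twoCocycle k L V) :=
  (LinearMap.range (d₁₂ k L V)).submoduleOf (twoCocycle k L V)

/-- `H²(L, V)`: Chevalley–Eilenberg 2-cocycles modulo 2-coboundaries. -/
abbrev H2 : Type _ := twoCocycle k L V ⧸ B2 k L V

/-- The alternating trilinear maps `L × L × L → V`. -/
def threeCochain : Submodule k (L →ₗ[k] L →ₗ[k] L →ₗ[k] V) where
  carrier := {c | (∀ x y, c x x y = 0) ∧ ∀ x y, c x y y = 0}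
  add_mem' {a b} ha hb := ⟨fun x y ↦ by simp [ha.1, hb.1], fun x y ↦ by simp [ha.2, hb.2]⟩
  zero_mem' := by simp
  smul_mem' t {c} hc := ⟨fun x y ↦ by simp [hc.1], fun x y ↦ by simp [hc.2]⟩

/-- The Chevalley–Eilenberg differential on 3-cochains. -/
def d₃₄ : threeCochain k L V →ₗ[k] (L → L → L → L → V) where
  toFun c w x y z :=
    ⁅w, c.1 x y z⁆ - ⁅x, c.1 w y z⁆ + ⁅y, c.1 w x z⁆ - ⁅z, c.1 w x y⁆
      - c.1 ⁅w, x⁆ y z + c.1 ⁅w, y⁆ x z - c.1 ⁅w, z⁆ x y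
      - c.1 ⁅x, y⁆ w z + c.1 ⁅x, z⁆ w y - c.1 ⁅y, z⁆ w x
  map_add' a b := by
    funext w x y z
    simp only [Submodule.coe_add, LinearMap.add_apply, lie_add, Pi.add_apply]
    abel
  map_smul' t a := by
    funext w x y z
    simp only [SetLike.val_smul, LinearMap.smul_apply, lie_smul, Pi.smul_apply, RingHom.id_apply,
      smul_add, smul_sub]

/-- The 3-cocycles. -/
def threeCocycle : Submodule k (threeCochain k L V) := LinearMap.ker (d₃₄ k L V)

/-- The 3-coboundaries, as a subspace of the 3-cocycles. -/
abbrev B3 : Submodule k (threeCocycle k L V) :=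
  (LinearMap.range (d₂₃ k L V)).comap
    ((threeCochain k L V).subtype ∘ₗ (threeCocycle k L V).subtype)

/-- `H³(L, V)`: Chevalley–Eilenberg 3-cocycles modulo 3-coboundaries. -/
abbrev H3 : Type _ := threeCocycle k L V ⧸ B3 k L V

end Cohomology

section Modules

variable {k : Type*} [CommRing k] {g : Type*} [LieRing g] [LieAlgebra k g] (h : LieIdeal k g)

/-- A `g`-module on which the ideal `h` acts trivially is a `g ⧸ h`-module, by `[x] · v = x · v`. -/
abbrev quotLieRingModule {V : Type*} [AddCommGroup V] [Module k V] [LieRingModule g V]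
    [LieModule k g V] (hV : ∀ z ∈ h, ∀ v : V, ⁅z, v⁆ = 0) : LieRingModule (g ⧸ h) V :=
  let T : (g ⧸ h) →ₗ[k] Module.End k V :=
    h.toSubmodule.liftQ (LieModule.toEnd k g V : g →ₗ[k] Module.End k V)
      (fun z hz ↦ LinearMap.mem_ker.mpr (LinearMap.ext fun v ↦ hV z hz v))
  { bracket := fun x v ↦ T x v
    add_lie := fun x y v ↦ by
      change T (x + y) v = T x v + T y v
      rw [map_add, LinearMap.add_apply]
    lie_add := fun x v w ↦ map_add (T x) v w
    leibniz_lie := by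
      rintro ⟨x⟩ ⟨y⟩ v
      exact leibniz_lie x y v }

theorem quotLieModule {V : Type*} [AddCommGroup V] [Module k V] [LieRingModule g V]
    [LieModule k g V] (hV : ∀ z ∈ h, ∀ v : V, ⁅z, v⁆ = 0) :
    letI := quotLieRingModule h hV
    LieModule k (g ⧸ h) V :=
  letI := quotLieRingModule h hV
  { smul_lie := by
      rintro t ⟨x⟩ v
      exact smul_lie t x v
    lie_smul := by
      rintro t ⟨x⟩ v
      exact lie_smul t x v }

variable (M : Type*) [AddCommGroup M] [Module k M] [LieRingModule g M] [LieModule k g M]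

/-- The submodule `M^h` of elements annihilated by the ideal `h`. -/
def invariants : LieSubmodule k g M where
  carrier := {m | ∀ z : h, ⁅z, m⁆ = 0}
  add_mem' {a b} ha hb z := by rw [lie_add, ha, hb, add_zero]
  zero_mem' z := lie_zero z
  smul_mem' t m hm z := by rw [lie_smul, hm, smul_zero]
  lie_mem {x m} hm z := by
    change ⁅(z : g), ⁅x, m⁆⁆ = 0
    have h1 : ⁅(z : g), m⁆ = 0 := hm z
    have h2 : ⁅⁅(z : g), x⁆, m⁆ = 0 := hm ⟨_, lie_mem_left k g h _ x z.2⟩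
    rw [leibniz_lie, h1, h2, lie_zero, add_zero]

theorem invariants_trivial (z : g) (hz : z ∈ h) (m : invariants h M) : ⁅z, m⁆ = 0 :=
  Subtype.ext (m.2 ⟨z, hz⟩)

instance : LieRingModule (g ⧸ h) (invariants h M) := quotLieRingModule h (invariants_trivial h M)

instance : LieModule k (g ⧸ h) (invariants h M) := quotLieModule h (invariants_trivial h M)

variable {M}

/-- The action of `g` on `Der(h, M)`: `(ˣd)(z) = x · d z - d [x, z]`. -/
instance derLieRingModule : LieRingModule g (LieDerivation k h M) where
  bracket x d :=
    { toFun := fun z ↦ ⁅x, d z⁆ - d ⁅x, z⁆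
      map_add' := fun a b ↦ by simp only [map_add, lie_add]; abel
      map_smul' := fun t a ↦ by simp only [map_smul, lie_smul, smul_sub, RingHom.id_apply]
      leibniz' := fun a b ↦ by
        have h1 : ∀ (z : h) (m : M), ⁅z, m⁆ = ⁅(z : g), m⁆ := fun _ _ ↦ rfl
        have h2 : ⁅x, ⁅a, b⁆⁆ = ⁅⁅x, a⁆, b⁆ + ⁅a, ⁅x, b⁆⁆ := Subtype.ext (leibniz_lie x (a : g) (b : g))
        have h3 : ∀ (z : h), ((⁅x, z⁆ : h) : g) = ⁅x, (z : g)⁆ := fun _ ↦ rfl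
        change ⁅x, d ⁅a, b⁆⁆ - d ⁅x, ⁅a, b⁆⁆
          = ⁅a, ⁅x, d b⁆ - d ⁅x, b⁆⁆ - ⁅b, ⁅x, d a⁆ - d ⁅x, a⁆⁆
        rw [h2, map_add]
        simp only [LieDerivation.apply_lie_eq_sub, lie_sub, h1, h3, lie_lie]
        abel }
  add_lie x y d := LieDerivation.ext fun z ↦ by
    change ⁅x + y, d z⁆ - d ⁅x + y, z⁆ = (⁅x, d z⁆ - d ⁅x, z⁆) + (⁅y, d z⁆ - d ⁅y, z⁆)
    simp only [add_lie, map_add]; abel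
  lie_add x d e := LieDerivation.ext fun z ↦ by
    change ⁅x, d z + e z⁆ - (d ⁅x, z⁆ + e ⁅x, z⁆) = (⁅x, d z⁆ - d ⁅x, z⁆) + (⁅x, e z⁆ - e ⁅x, z⁆)
    simp only [lie_add]; abel
  leibniz_lie x y d := LieDerivation.ext fun z ↦ by
    change ⁅x, ⁅y, d z⁆ - d ⁅y, z⁆⁆ - (⁅y, d ⁅x, z⁆⁆ - d ⁅y, ⁅x, z⁆⁆)
      = (⁅⁅x, y⁆, d z⁆ - d ⁅⁅x, y⁆, z⁆) + (⁅y, ⁅x, d z⁆ - d ⁅x, z⁆⁆ - (⁅x, d ⁅y, z⁆⁆ - d ⁅x, ⁅y, z⁆⁆))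
    simp only [lie_lie, lie_sub, map_sub]
    abel

theorem der_lie_apply (x : g) (d : LieDerivation k h M) (z : h) :
    ⁅x, d⁆ z = ⁅x, d z⁆ - d ⁅x, z⁆ := rfl

instance derLieModule : LieModule k g (LieDerivation k h M) where
  smul_lie t x d := LieDerivation.ext fun z ↦ by
    change ⁅t • x, d z⁆ - d ⁅t • x, z⁆ = t • (⁅x, d z⁆ - d ⁅x, z⁆)
    simp only [smul_lie, map_smul, smul_sub]
  lie_smul t x d := LieDerivation.ext fun z ↦ by
    change ⁅x, t • d z⁆ - t • d ⁅x, z⁆ = t • (⁅x, d z⁆ - d ⁅x, z⁆)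
    simp only [lie_smul, smul_sub]

theorem lie_inner (x : g) (m : M) :
    ⁅x, LieDerivation.inner k h M m⁆ = LieDerivation.inner k h M ⁅x, m⁆ :=
  LieDerivation.ext fun z ↦ by
    change ⁅x, ⁅(z : g), m⁆⁆ - ⁅⁅x, (z : g)⁆, m⁆ = ⁅(z : g), ⁅x, m⁆⁆
    rw [lie_lie]; abel

theorem lie_mem_der (z : h) (d : LieDerivation k h M) :
    ⁅(z : g), d⁆ = LieDerivation.inner k h M (d z) :=
  LieDerivation.ext fun w ↦ by
    change ⁅z, d w⁆ - d ⁅z, w⁆ = ⁅w, d z⁆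
    rw [LieDerivation.apply_lie_eq_sub]; abel

/-- `Inn(h, M)` as a `g`-submodule of `Der(h, M)`. -/
def innLieSubmodule : LieSubmodule k g (LieDerivation k h M) where
  toSubmodule := Inn k h M
  lie_mem {x d} hd := by
    obtain ⟨m, rfl⟩ := hd
    exact ⟨⁅x, m⁆, (lie_inner h x m).symm⟩

/-- The action of `g` on `H¹(h, M)` induced by the action on `Der(h, M)`. -/
instance h1LieRingModuleAux : LieRingModule g (H1 k h M) :=
  inferInstanceAs (LieRingModule g (LieDerivation k h M ⧸ innLieSubmodule h))

instance h1LieModuleAux : LieModule k g (H1 k h M) :=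
  inferInstanceAs (LieModule k g (LieDerivation k h M ⧸ innLieSubmodule (M := M) h))

theorem h1_trivial (z : g) (hz : z ∈ h) (c : H1 k h M) : ⁅z, c⁆ = 0 := by
  obtain ⟨d, rfl⟩ := (Inn k h M).mkQ_surjective c
  change (Inn k h M).mkQ ⁅z, d⁆ = 0
  rw [Submodule.mkQ_apply, Submodule.Quotient.mk_eq_zero]
  exact ⟨d ⟨z, hz⟩, (lie_mem_der h ⟨z, hz⟩ d).symm⟩

/-- The action of `g ⧸ h` on `H¹(h, M)`. -/
instance : LieRingModule (g ⧸ h) (H1 k h M) := quotLieRingModule h (h1_trivial h)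

instance : LieModule k (g ⧸ h) (H1 k h M) := quotLieModule h (h1_trivial h)

theorem mk_lie_mk (x : g) (d : LieDerivation k h M) :
    ⁅(LieSubmodule.Quotient.mk x : g ⧸ h), (Inn k h M).mkQ d⁆ = (Inn k h M).mkQ ⁅x, d⁆ := rfl

end Modules

section Extensions

variable {k : Type*} [Field k] {L : Type*} [LieRing L] [LieAlgebra k L]
variable {V : Type*} [AddCommGroup V] [Module k V] [LieRingModule L V] [LieModule k L V]

variable (k L V) in
/-- Extensions `0 → V → E → L → 0` of `L` by the `L`-module `V` (regarded as an abelian Lie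
algebra) for which the action of `L` on `V` induced by the bracket of `E` is the given one. -/
structure ModExt where
  E : Type w
  [lieRing : LieRing E]
  [lieAlgebra : LieAlgebra k E]
  incl : V →ₗ[k] E
  proj : E →ₗ⁅k⁆ L
  incl_injective : Function.Injective incl
  proj_surjective : Function.Surjective proj
  exact : ∀ e, proj e = 0 ↔ ∃ v, incl v = e
  lie_incl : ∀ e v, ⁅e, incl v⁆ = incl ⁅proj e, v⁆

attribute [instance] ModExt.lieRing ModExt.lieAlgebra

namespace ModExt

variable (X : ModExt.{w} k L V)

theorem proj_incl (v : V) : X.proj (X.incl v) = 0 := (X.exact _).2 ⟨v, rfl⟩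

theorem exists_section : ∃ s : L →ₗ[k] X.E, ∀ x, X.proj (s x) = x := by
  obtain ⟨s, hs⟩ := LinearMap.exists_rightInverse_of_surjective (X.proj : X.E →ₗ[k] L)
    (LinearMap.range_eq_top.2 X.proj_surjective)
  exact ⟨s, fun x ↦ LinearMap.congr_fun hs x⟩

/-- A linear retraction of `incl`; used only on the image of `incl`, where it is `incl⁻¹`. -/
noncomputable def retr : X.E →ₗ[k] V :=
  (LinearMap.exists_leftInverse_of_injective X.incl
    (LinearMap.ker_eq_bot.2 X.incl_injective)).choose

theorem retr_incl (v : V) : X.retr (X.incl v) = v :=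
  LinearMap.congr_fun (LinearMap.exists_leftInverse_of_injective X.incl
    (LinearMap.ker_eq_bot.2 X.incl_injective)).choose_spec v

theorem incl_retr {e : X.E} (he : X.proj e = 0) : X.incl (X.retr e) = e := by
  obtain ⟨v, rfl⟩ := (X.exact e).1 he
  rw [retr_incl]

/-- The 2-cochain `f` with `incl (f x y) = [s x, s y] - s [x, y]`. -/
noncomputable def cochain (s : L →ₗ[k] X.E) : twoCochain k L V :=
  ⟨LinearMap.mk₂ k (fun x y ↦ X.retr (⁅s x, s y⁆ - s ⁅x, y⁆))
    (fun a b c ↦ by rw [← map_add]; congr 1; simp only [map_add, add_lie]; abel)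
    (fun t a b ↦ by rw [← map_smul]; congr 1; simp only [map_smul, smul_lie, smul_sub])
    (fun a b c ↦ by rw [← map_add]; congr 1; simp only [map_add, lie_add]; abel)
    (fun t a b ↦ by rw [← map_smul]; congr 1; simp only [map_smul, lie_smul, smul_sub]),
    fun x ↦ by simp⟩

theorem incl_cochain (s : L →ₗ[k] X.E) (hs : ∀ x, X.proj (s x) = x) (x y : L) :
    X.incl (X.cochain s x y) = ⁅s x, s y⁆ - s ⁅x, y⁆ :=
  X.incl_retr (by rw [map_sub, LieHom.map_lie, hs, hs, hs, sub_self])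

/-- The 2-cocycle associated with a linear section of an extension. -/
noncomputable def cocycle (s : L →ₗ[k] X.E) (hs : ∀ x, X.proj (s x) = x) : twoCocycle k L V :=
  ⟨X.cochain s, by
    rw [mem_twoCocycle_iff]
    ext x y z
    apply X.incl_injective
    have key : ∀ (u : L) (v : V), X.incl ⁅u, v⁆ = ⁅s u, X.incl v⁆ := fun u v ↦ by
      rw [X.lie_incl, hs]
    have e1 : ⁅⁅x, y⁆, z⁆ = ⁅x, ⁅y, z⁆⁆ - ⁅y, ⁅x, z⁆⁆ := lie_lie x y z
    have e2 : ⁅⁅x, z⁆, y⁆ = - ⁅y, ⁅x, z⁆⁆ := (lie_skew _ _).symm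
    have e3 : ⁅⁅y, z⁆, x⁆ = - ⁅x, ⁅y, z⁆⁆ := (lie_skew _ _).symm
    have a1 : ⁅s z, ⁅s x, s y⁆⁆ = - (⁅s x, ⁅s y, s z⁆⁆ - ⁅s y, ⁅s x, s z⁆⁆) := by
      rw [← lie_lie, lie_skew]
    have a2 : ⁅s ⁅x, y⁆, s z⁆ = - ⁅s z, s ⁅x, y⁆⁆ := (lie_skew _ _).symm
    have a3 : ⁅s ⁅x, z⁆, s y⁆ = - ⁅s y, s ⁅x, z⁆⁆ := (lie_skew _ _).symm
    have a4 : ⁅s ⁅y, z⁆, s x⁆ = - ⁅s x, s ⁅y, z⁆⁆ := (lie_skew _ _).symm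
    simp only [d₂₃_apply, map_sub, map_add, key, X.incl_cochain s hs, lie_sub, e1, e2, e3, a1, a2,
      a3, a4, map_neg, LinearMap.zero_apply, map_zero]
    abel⟩

/-- The class in `H²(L, V)` of an extension: the class of the cocycle of any linear section. -/
noncomputable def cls : H2 k L V :=
  (B2 k L V).mkQ (X.cocycle X.exists_section.choose X.exists_section.choose_spec)

end ModExt

/-- The extension `0 → V → V ×_f L → L → 0` given by a 2-cocycle `f`: pairs `(x, v)`, `x ∈ L`,
`v ∈ V`, with `[(x, v), (x', v')] = ([x, x'], f x x' + x · v' - x' · v)`. -/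
def twistedExt (f : twoCocycle k L V) : ModExt k L V where
  E := LieAlgebra.ofTwoCocycle f
  incl :=
    { toFun := fun v ↦ ⟨(0, v)⟩
      map_add' := fun a b ↦ congrArg LieAlgebra.ofTwoCocycle.mk (Prod.ext (add_zero _).symm rfl)
      map_smul' := fun t a ↦ congrArg LieAlgebra.ofTwoCocycle.mk (Prod.ext (smul_zero _).symm rfl) }
  proj :=
    { toFun := fun e ↦ e.carrier.1
      map_add' := fun a b ↦ rfl
      map_smul' := fun t a ↦ rfl
      map_lie' := rfl }
  incl_injective a b hab := congrArg (fun e ↦ e.carrier.2) hab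
  proj_surjective x := ⟨⟨(x, 0)⟩, rfl⟩
  exact e := by
    obtain ⟨x, v⟩ := e
    constructor
    · intro hx
      have hx' : x = 0 := hx
      exact ⟨v, by rw [hx']; rfl⟩
    · rintro ⟨v', hv⟩
      exact (congrArg (fun e ↦ e.carrier.1) hv).symm
  lie_incl e v := by
    refine congrArg LieAlgebra.ofTwoCocycle.mk (Prod.ext ?_ ?_)
    · exact lie_zero _
    · change f.1 e.carrier.1 0 + ⁅e.carrier.1, v⁆ - ⁅(0 : L), e.carrier.2⁆ = ⁅e.carrier.1, v⁆
      rw [map_zero, zero_lie, zero_add, sub_zero]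

variable (k L V) in
/-- The semi-direct product of `L` with the module `V`: pairs `(x, v)` with
`[(x, v), (x', v')] = ([x, x'], x · v' - x' · v)`. -/
abbrev SemiProd : Type _ := LieAlgebra.ofTwoCocycle (0 : twoCocycle k L V)

theorem semiProd_lie (a b : SemiProd k L V) :
    ⁅a, b⁆ = ⟨(⁅a.carrier.1, b.carrier.1⁆,
      ⁅a.carrier.1, b.carrier.2⁆ - ⁅b.carrier.1, a.carrier.2⁆)⟩ := by
  refine congrArg LieAlgebra.ofTwoCocycle.mk (Prod.ext rfl ?_)
  change (0 : V) + ⁅a.carrier.1, b.carrier.2⁆ - ⁅b.carrier.1, a.carrier.2⁆ = _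
  rw [zero_add]

theorem semiProd_add (a b : SemiProd k L V) :
    a + b = ⟨(a.carrier.1 + b.carrier.1, a.carrier.2 + b.carrier.2)⟩ := rfl

theorem semiProd_smul (t : k) (a : SemiProd k L V) :
    t • a = ⟨(t • a.carrier.1, t • a.carrier.2)⟩ := rfl

theorem semiProd_ext {a b : SemiProd k L V}
    (h1 : a.carrier.1 = b.carrier.1) (h2 : a.carrier.2 = b.carrier.2) : a = b :=
  congrArg LieAlgebra.ofTwoCocycle.mk (Prod.ext h1 h2)

end Extensions

section PartialSplittings

variable {k : Type*} [Field k] {g : Type*} [LieRing g] [LieAlgebra k g] {h : LieIdeal k g}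
variable {M : Type*} [AddCommGroup M] [Module k M] [LieRingModule g M] [LieModule k g M]

/-- A partial splitting over `h` of an extension of `g`: a Lie algebra map `s : h → E` with
`proj (s z) = z`. -/
structure PartialSplitting (h : LieIdeal k g) (X : ModExt.{w} k g M) where
  s : h →ₗ⁅k⁆ X.E
  proj_s : ∀ z : h, X.proj (s z) = z

namespace PartialSplitting

variable {X : ModExt.{w} k g M} (S : PartialSplitting h X)

theorem proj_defect (e : X.E) (z : h) : X.proj (⁅e, S.s z⁆ - S.s ⁅X.proj e, z⁆) = 0 := by
  rw [map_sub, LieHom.map_lie, S.proj_s, S.proj_s]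
  exact sub_self _

/-- The derivation `d_e : h → M`, `d_e z = [e, s z] - s [proj e, z]`. -/
noncomputable def der : X.E →ₗ[k] LieDerivation k h M where
  toFun e :=
    { toFun := fun z ↦ X.retr (⁅e, S.s z⁆ - S.s ⁅X.proj e, z⁆)
      map_add' := fun a b ↦ by
        rw [← map_add]; congr 1; simp only [map_add, lie_add]; abel
      map_smul' := fun t a ↦ by
        rw [← map_smul]; congr 1; simp only [map_smul, lie_smul, smul_sub, RingHom.id_apply]
      leibniz' := fun a b ↦ by
        apply X.incl_injective
        have h1 : ∀ (z : h) (m : M), X.incl ⁅z, m⁆ = ⁅S.s z, X.incl m⁆ := fun z m ↦ by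
          rw [X.lie_incl, S.proj_s]; rfl
        change X.incl (X.retr (⁅e, S.s ⁅a, b⁆⁆ - S.s ⁅X.proj e, ⁅a, b⁆⁆)) =
          X.incl (⁅a, X.retr (⁅e, S.s b⁆ - S.s ⁅X.proj e, b⁆)⁆
            - ⁅b, X.retr (⁅e, S.s a⁆ - S.s ⁅X.proj e, a⁆)⁆)
        rw [map_sub X.incl, h1, h1, X.incl_retr (S.proj_defect e _),
          X.incl_retr (S.proj_defect e _), X.incl_retr (S.proj_defect e _)]
        have h2 : ⁅X.proj e, ⁅a, b⁆⁆ = ⁅⁅X.proj e, a⁆, b⁆ + ⁅a, ⁅X.proj e, b⁆⁆ :=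
          Subtype.ext (leibniz_lie (X.proj e) (a : g) (b : g))
        rw [h2, map_add]
        simp only [LieHom.map_lie, lie_sub]
        rw [leibniz_lie e (S.s a) (S.s b), ← lie_skew (S.s b) ⁅e, S.s a⁆,
          ← lie_skew (S.s b) (S.s ⁅X.proj e, a⁆)]
        abel }
  map_add' e e' := LieDerivation.ext fun z ↦ by
    change X.retr _ = X.retr _ + X.retr _
    rw [← map_add]; congr 1; simp only [map_add, add_lie]; abel
  map_smul' t e := LieDerivation.ext fun z ↦ by
    change X.retr _ = t • X.retr _
    rw [← map_smul]; congr 1; simp only [map_smul, smul_lie, smul_sub]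

theorem incl_der (e : X.E) (z : h) :
    X.incl (S.der e z) = ⁅e, S.s z⁆ - S.s ⁅X.proj e, z⁆ := X.incl_retr (S.proj_defect e z)

/-- The largest subalgebra `I_E(s(h))` of `E` in which `s(h)` is an ideal. -/
def idealizer : LieSubalgebra k X.E := S.s.range.normalizer

theorem s_mem_idealizer (z : h) : S.s z ∈ S.idealizer :=
  S.s.range.le_normalizer (LieHom.mem_range_self S.s z)

/-- `s(h)`, as an ideal of `I_E(s(h))`. -/
def image : LieIdeal k S.idealizer where
  toSubmodule := S.s.range.toSubmodule.comap S.idealizer.toSubmodule.subtype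
  lie_mem {x e} he := (S.s.range.mem_normalizer_iff x).1 x.2 e he

theorem mem_image (e : S.idealizer) : e ∈ S.image ↔ ∃ z, S.s z = e := LieHom.mem_range S.s (e : X.E)

theorem mem_idealizer_iff (e : X.E) : e ∈ S.idealizer ↔ ∀ z, ⁅e, S.s z⁆ = S.s ⁅X.proj e, z⁆ := by
  rw [idealizer, LieSubalgebra.mem_normalizer_iff]
  constructor
  · intro H z
    obtain ⟨w, hw⟩ := H _ (LieHom.mem_range_self S.s z)
    have : w = ⁅X.proj e, z⁆ := by
      apply Subtype.ext
      have hw' : S.s w = ⁅e, S.s z⁆ := hw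
      rw [← S.proj_s w, hw', LieHom.map_lie, S.proj_s]
      rfl
    rw [← this]; exact hw.symm
  · rintro H _ ⟨z, rfl⟩
    exact ⟨_, (H z).symm⟩

theorem incl_mem_idealizer (m : M) : X.incl m ∈ S.idealizer ↔ m ∈ invariants h M := by
  rw [mem_idealizer_iff]
  refine forall_congr' fun z ↦ ?_
  rw [X.proj_incl, zero_lie, map_zero, ← lie_skew, neg_eq_zero, X.lie_incl, S.proj_s]
  constructor
  · intro H
    exact X.incl_injective (by rw [map_zero]; exact H)
  · intro H
    rw [show ⁅(z : g), m⁆ = 0 from H, map_zero]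

/-- For a partial splitting all of whose derivations `d_e` are inner, the extension
`0 → M^h → I_E(s(h)) / s(h) → g / h → 0`. -/
noncomputable def omega (hS : ∀ e, S.der e ∈ Inn k h M) :
    ModExt k (g ⧸ h) (invariants h M) where
  E := S.idealizer ⧸ S.image
  incl := (LieSubmodule.Quotient.mk' S.image : S.idealizer →ₗ[k] S.idealizer ⧸ S.image) ∘ₗ
    (X.incl ∘ₗ (invariants h M).toSubmodule.subtype).codRestrict S.idealizer.toSubmodule
      (fun m ↦ (S.incl_mem_idealizer _).2 m.2)
  proj :=
    { S.image.toSubmodule.mapQ h.toSubmodule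
        ((X.proj : X.E →ₗ[k] g) ∘ₗ S.idealizer.toSubmodule.subtype)
        (by
          intro e he
          obtain ⟨z, hz⟩ := (S.mem_image e).1 he
          change X.proj (e : X.E) ∈ h
          rw [← hz]
          exact (S.proj_s z).symm ▸ z.2) with
      map_lie' := by
        rintro ⟨x⟩ ⟨y⟩
        exact congrArg (LieSubmodule.Quotient.mk (N := h)) (X.proj.map_lie x y) }
  incl_injective := by
    rw [← LinearMap.ker_eq_bot, LinearMap.ker_eq_bot']
    intro m hm
    obtain ⟨z, hz⟩ := (S.mem_image _).1 ((LieSubmodule.Quotient.mk_eq_zero' (N := S.image)).1 hm)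
    have hz' : S.s z = X.incl m := hz
    have h0 : z = 0 := Subtype.ext (by rw [← S.proj_s z, hz', X.proj_incl]; rfl)
    rw [h0, map_zero] at hz'
    exact Subtype.ext (X.incl_injective (by rw [← hz']; exact (map_zero X.incl).symm))
  proj_surjective := by
    rintro ⟨x⟩
    obtain ⟨e, he⟩ := X.proj_surjective x
    obtain ⟨m, hm⟩ := hS e
    refine ⟨LieSubmodule.Quotient.mk ⟨e + X.incl m, ?_⟩, ?_⟩
    · rw [mem_idealizer_iff]
      intro z
      have h1 : X.incl (LieDerivation.inner k h M m z) = ⁅S.s z, X.incl m⁆ := by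
        rw [X.lie_incl, S.proj_s]; rfl
      rw [hm, S.incl_der] at h1
      rw [add_lie, ← lie_skew (X.incl m), ← h1, map_add, X.proj_incl, add_zero]
      abel
    · change LieSubmodule.Quotient.mk (N := h) (X.proj (e + X.incl m)) = _
      rw [map_add, X.proj_incl, add_zero, he]
      rfl
  exact := by
    rintro ⟨e⟩
    constructor
    · intro he
      have he' : X.proj (e : X.E) ∈ h := (LieSubmodule.Quotient.mk_eq_zero' (N := h)).1 he
      have h0 : X.proj ((e : X.E) - S.s ⟨_, he'⟩) = 0 := by
        rw [map_sub, S.proj_s, sub_self]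
      obtain ⟨m, hm⟩ := (X.exact _).1 h0
      have hm' : m ∈ invariants h M := by
        rw [← S.incl_mem_idealizer, hm]
        exact sub_mem e.2 (S.s_mem_idealizer _)
      refine ⟨⟨m, hm'⟩, ?_⟩
      refine (Submodule.Quotient.eq S.image.toSubmodule).2 ?_
      refine (S.mem_image _).2 ⟨-⟨_, he'⟩, ?_⟩
      change _ = X.incl m - (e : X.E)
      rw [hm, sub_sub_cancel_left, map_neg]
    · rintro ⟨m, hm⟩
      rw [← hm]
      change LieSubmodule.Quotient.mk (N := h) (X.proj (X.incl m)) = 0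
      rw [X.proj_incl]
      rfl
  lie_incl := by
    rintro ⟨e⟩ m
    refine congrArg (LieSubmodule.Quotient.mk (N := S.image)) (Subtype.ext ?_)
    exact X.lie_incl e m

/-- `[d_e]` depends only on the image of `e` in `g / h`. -/
theorem der_mem_inn {e : X.E} (he : X.proj e ∈ h) : S.der e ∈ Inn k h M := by
  have h0 : X.proj (e - S.s ⟨_, he⟩) = 0 := by rw [map_sub, S.proj_s, sub_self]
  obtain ⟨m, hm⟩ := (X.exact _).1 h0
  refine ⟨-m, LieDerivation.ext fun z ↦ X.incl_injective ?_⟩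
  have h1 : ⁅S.s ⟨_, he⟩, S.s z⁆ = S.s ⁅X.proj e, z⁆ := by
    rw [← LieHom.map_lie]; rfl
  rw [S.incl_der, ← h1, ← sub_lie, ← hm, ← lie_skew, X.lie_incl, S.proj_s]
  change X.incl ⁅(z : g), -m⁆ = _
  rw [lie_neg, map_neg]

/-- The linear map `g / h → H¹(h, M)` sending the class of `proj e` to `[d_e]`. -/
noncomputable def rhoLin : (g ⧸ h) →ₗ[k] H1 k h M :=
  (Inn k h M).mkQ ∘ₗ S.der ∘ₗ
    (LinearMap.exists_rightInverse_of_surjective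
      (h.toSubmodule.mkQ ∘ₗ (X.proj : X.E →ₗ[k] g))
      (LinearMap.range_eq_top.2 (h.toSubmodule.mkQ_surjective.comp X.proj_surjective))).choose

theorem rhoLin_mk_proj (e : X.E) :
    S.rhoLin (LieSubmodule.Quotient.mk (X.proj e) : g ⧸ h) = (Inn k h M).mkQ (S.der e) := by
  have H := (LinearMap.exists_rightInverse_of_surjective
      (h.toSubmodule.mkQ ∘ₗ (X.proj : X.E →ₗ[k] g))
      (LinearMap.range_eq_top.2
        (h.toSubmodule.mkQ_surjective.comp X.proj_surjective))).choose_spec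
  have H' := LinearMap.congr_fun H (LieSubmodule.Quotient.mk (X.proj e) : g ⧸ h)
  rw [rhoLin]
  refine (Submodule.Quotient.eq _).2 ?_
  change S.der _ - S.der e ∈ Inn k h M
  rw [← map_sub]
  apply der_mem_inn
  rw [map_sub]
  exact (Submodule.Quotient.eq h.toSubmodule).1 H'

/-- The derivation `g / h → H¹(h, M)` sending the class of `proj e` to `[d_e]`. -/
noncomputable def rhoDer : LieDerivation k (g ⧸ h) (H1 k h M) where
  toLinearMap := S.rhoLin
  leibniz' := by
    rintro ⟨x⟩ ⟨y⟩
    obtain ⟨a, rfl⟩ := X.proj_surjective x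
    obtain ⟨b, rfl⟩ := X.proj_surjective y
    change S.rhoLin (LieSubmodule.Quotient.mk ⁅X.proj a, X.proj b⁆) =
      ⁅(LieSubmodule.Quotient.mk (X.proj a) : g ⧸ h),
        S.rhoLin (LieSubmodule.Quotient.mk (X.proj b))⁆ -
      ⁅(LieSubmodule.Quotient.mk (X.proj b) : g ⧸ h),
        S.rhoLin (LieSubmodule.Quotient.mk (X.proj a))⁆
    rw [← LieHom.map_lie, rhoLin_mk_proj, rhoLin_mk_proj, rhoLin_mk_proj, mk_lie_mk, mk_lie_mk,
      ← map_sub]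
    congr 1
    refine LieDerivation.ext fun z ↦ X.incl_injective ?_
    rw [LieDerivation.sub_apply, der_lie_apply, der_lie_apply]
    have h2 : ⁅⁅X.proj a, X.proj b⁆, z⁆ = ⁅X.proj a, ⁅X.proj b, z⁆⁆ - ⁅X.proj b, ⁅X.proj a, z⁆⁆ :=
      Subtype.ext (lie_lie (X.proj a) (X.proj b) (z : g))
    simp only [map_sub, S.incl_der, ← X.lie_incl, LieHom.map_lie, h2, lie_sub, lie_lie]
    abel

end PartialSplitting
end PartialSplittings

section TrRho

variable {k : Type*} [Field k] {g : Type*} [LieRing g] [LieAlgebra k g] {h : LieIdeal k g}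
variable {M : Type*} [AddCommGroup M] [Module k M] [LieRingModule g M] [LieModule k g M]

/-- The partial splitting `z ↦ (z, γ z)` of `M ×_f g`, for a linear map `γ : h → M` that makes it
a Lie algebra map. -/
def twistedSplitting (f : twoCocycle k g M) (γ : h →ₗ[k] M)
    (hγ : ∀ z w : h, f.1 z w = γ ⁅z, w⁆ - ⁅z, γ w⁆ + ⁅w, γ z⁆) :
    PartialSplitting h (twistedExt f) where
  s :=
    { toFun := fun z ↦ (⟨((z : g), γ z)⟩ : LieAlgebra.ofTwoCocycle f)
      map_add' := fun a b ↦ congrArg LieAlgebra.ofTwoCocycle.mk (Prod.ext rfl (map_add γ a b))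
      map_smul' := fun t a ↦ congrArg LieAlgebra.ofTwoCocycle.mk (Prod.ext rfl (map_smul γ t a))
      map_lie' := fun {a b} ↦ by
        refine congrArg LieAlgebra.ofTwoCocycle.mk (Prod.ext rfl ?_)
        change γ ⁅a, b⁆ = f.1 a b + ⁅a, γ b⁆ - ⁅b, γ a⁆
        rw [hγ]; abel }
  proj_s z := rfl

/-- The partial splitting `s_d : z ↦ (z, d z)` of the semi-direct product of `g` with `M` given by
a derivation `d : h → M`. -/
def sd (d : LieDerivation k h M) : PartialSplitting h (twistedExt (0 : twoCocycle k g M)) :=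
  twistedSplitting 0 d.toLinearMap fun z w ↦ by
    change 0 = d ⁅z, w⁆ - ⁅z, d w⁆ + ⁅w, d z⁆
    rw [LieDerivation.apply_lie_eq_sub]; abel

theorem sd_der (d : LieDerivation k h M) (e : SemiProd k g M) :
    (sd d).der e = ⁅e.carrier.1, d⁆ - LieDerivation.inner k h M e.carrier.2 := by
  refine LieDerivation.ext fun z ↦ (twistedExt (0 : twoCocycle k g M)).incl_injective ?_
  refine ((sd d).incl_der e z).trans ?_
  change ⁅e, (⟨((z : g), d z)⟩ : SemiProd k g M)⁆ -
    (⟨(⁅e.carrier.1, (z : g)⁆, d ⁅e.carrier.1, z⁆)⟩ : SemiProd k g M) =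
      ⟨(0, (⁅e.carrier.1, d z⁆ - d ⁅e.carrier.1, z⁆) - ⁅(z : g), e.carrier.2⁆)⟩
  rw [semiProd_lie]
  refine congrArg LieAlgebra.ofTwoCocycle.mk (Prod.ext (sub_self _) ?_)
  exact sub_right_comm _ _ _

variable (k h M) in
/-- The invariants `H¹(h, M)^{g/h}`. -/
abbrev H1inv : LieSubmodule k (g ⧸ h) (H1 k h M) :=
  LieModule.maxTrivSubmodule k (g ⧸ h) (H1 k h M)

theorem sd_der_mem_inn (d : LieDerivation k h M) (hd : (Inn k h M).mkQ d ∈ H1inv k h M)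
    (e : SemiProd k g M) : (sd d).der e ∈ Inn k h M := by
  rw [sd_der]
  refine sub_mem ?_ (LinearMap.mem_range_self _ _)
  have := (LieModule.mem_maxTrivSubmodule k (g ⧸ h) (H1 k h M) _).1 hd (LieSubmodule.Quotient.mk e.carrier.1)
  rw [mk_lie_mk] at this
  exact (Submodule.Quotient.mk_eq_zero _).1 this

/-- The class in `H²(g / h, M^h)` of the extension
`0 → M^h → I(s_d(h)) / s_d(h) → g / h → 0`, where `I(s_d(h)) ⊆ M ⋊ g`. -/
noncomputable def trHat (d : LieDerivation k h M) (hd : (Inn k h M).mkQ d ∈ H1inv k h M) :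
    H2 k (g ⧸ h) (invariants h M) :=
  ((sd d).omega (sd_der_mem_inn d hd)).cls

/-- The map `tr : H¹(h, M)^{g/h} → H²(g / h, M^h)` induced by `trHat`. -/
noncomputable def tr (ξ : H1inv k h M) : H2 k (g ⧸ h) (invariants h M) :=
  trHat ((Inn k h M).mkQ_surjective ξ.1).choose
    (by rw [((Inn k h M).mkQ_surjective ξ.1).choose_spec]; exact ξ.2)

variable (h M) in
/-- Restriction of 2-cocycles from `g` to `h`. -/
def resCocycle : twoCocycle k g M →ₗ[k] twoCocycle k h M where
  toFun f := ⟨⟨f.1.1.domRestrict₁₂ h.toSubmodule h.toSubmodule, fun x ↦ f.1.2 (x : g)⟩, by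
    rw [mem_twoCocycle_iff]
    ext x y z
    have := (mem_twoCocycle_iff k g M f.1).1 f.2
    exact LinearMap.congr_fun (LinearMap.congr_fun (LinearMap.congr_fun this x) y) z⟩
  map_add' _ _ := rfl
  map_smul' _ _ := rfl

variable (h M) in
/-- The restriction map `H²(g, M) → H²(h, M)`. -/
def resH2 : H2 k g M →ₗ[k] H2 k h M :=
  (B2 k g M).mapQ (B2 k h M) (resCocycle h M) (by
    rintro f ⟨c, hc⟩
    exact ⟨c ∘ₗ h.toSubmodule.subtype, Subtype.ext (LinearMap.ext fun x ↦ LinearMap.ext fun y ↦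
      LinearMap.congr_fun (LinearMap.congr_fun (congrArg Subtype.val hc) (x : g)) (y : g))⟩)

variable (k h M) in
/-- `H²(g, M)₁`, the kernel of the restriction map `H²(g, M) → H²(h, M)`. -/
abbrev H2one : Submodule k (H2 k g M) := LinearMap.ker (resH2 h M)

theorem exists_partialSplitting (f : twoCocycle k g M) (hf : (B2 k g M).mkQ f ∈ H2one k h M) :
    Nonempty (PartialSplitting h (twistedExt f)) := by
  obtain ⟨c, hc⟩ := (Submodule.Quotient.mk_eq_zero (B2 k h M)).1 (LinearMap.mem_ker.1 hf)
  refine ⟨twistedSplitting f (-c) fun z w ↦ ?_⟩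
  have h1 : ⁅z, c w⁆ - ⁅w, c z⁆ - c ⁅z, w⁆ = f.1 z w :=
    LinearMap.congr_fun (LinearMap.congr_fun (congrArg Subtype.val hc) z) w
  rw [← h1]
  simp only [LinearMap.neg_apply, lie_neg]
  abel

/-- The class in `H¹(g / h, H¹(h, M))` of the derivation given by a partial splitting. -/
noncomputable def rhoHat {X : ModExt.{w} k g M} (S : PartialSplitting h X) :
    H1 k (g ⧸ h) (H1 k h M) :=
  (Inn k (g ⧸ h) (H1 k h M)).mkQ S.rhoDer

/-- The map `ρ : H²(g, M)₁ → H¹(g / h, H¹(h, M))` induced by `rhoHat`: take an extension with the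
given class and a partial splitting of it. -/
noncomputable def rho (ξ : H2one k h M) : H1 k (g ⧸ h) (H1 k h M) :=
  rhoHat (exists_partialSplitting ((B2 k g M).mkQ_surjective ξ.1).choose
    (by rw [((B2 k g M).mkQ_surjective ξ.1).choose_spec]; exact ξ.2)).some

end TrRho

section Crossed

variable {k : Type*} [Field k] {q : Type*} [LieRing q] [LieAlgebra k q]
variable {V : Type*} [AddCommGroup V] [Module k V] [LieRingModule q V] [LieModule k q V]

theorem exists_quasiInverse {A B : Type*} [AddCommGroup A] [Module k A] [AddCommGroup B]
    [Module k B] (f : A →ₗ[k] B) : ∃ t : B →ₗ[k] A, ∀ a, f (t (f a)) = f a := by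
  obtain ⟨t, ht⟩ := f.rangeRestrict.exists_rightInverse_of_surjective
    (LinearMap.range_rangeRestrict _)
  obtain ⟨r, hr⟩ := LinearMap.exists_leftInverse_of_injective
    (LinearMap.range f).subtype (Submodule.ker_subtype _)
  refine ⟨t ∘ₗ r, fun a ↦ ?_⟩
  have h1 : r (f a) = f.rangeRestrict a := LinearMap.congr_fun hr (f.rangeRestrict a)
  rw [LinearMap.comp_apply, h1]
  exact congrArg Subtype.val (LinearMap.congr_fun ht (f.rangeRestrict a))

variable (k q V) in
/-- Crossed extensions `0 → V → m → n → q → 0`: exact sequences in which `bnd : m → n` is a crossed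
module and the induced action of `q` on `V` is the given one. -/
structure CrossedExt where
  m : Type u
  n : Type v
  [lieRingM : LieRing m]
  [lieAlgebraM : LieAlgebra k m]
  [lieRingN : LieRing n]
  [lieAlgebraN : LieAlgebra k n]
  act : n →ₗ⁅k⁆ LieDerivation k m m
  bnd : m →ₗ⁅k⁆ n
  incl : V →ₗ[k] m
  proj : n →ₗ⁅k⁆ q
  bnd_act : ∀ x a, bnd (act x a) = ⁅x, bnd a⁆
  act_bnd : ∀ a b, act (bnd a) b = ⁅a, b⁆
  incl_injective : Function.Injective incl
  exact_left : ∀ a, bnd a = 0 ↔ ∃ v, incl v = a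
  exact_right : ∀ x, proj x = 0 ↔ ∃ a, bnd a = x
  proj_surjective : Function.Surjective proj
  act_incl : ∀ x v, act x (incl v) = incl ⁅proj x, v⁆

attribute [instance] CrossedExt.lieRingM CrossedExt.lieAlgebraM CrossedExt.lieRingN
  CrossedExt.lieAlgebraN

namespace CrossedExt

variable (X : CrossedExt.{u, v} k q V)

/-- A linear retraction of `incl`; used only on the image of `incl`, where it is `incl⁻¹`. -/
noncomputable def retr : X.m →ₗ[k] V :=
  (LinearMap.exists_leftInverse_of_injective X.incl
    (LinearMap.ker_eq_bot.2 X.incl_injective)).choose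

theorem retr_incl (v : V) : X.retr (X.incl v) = v :=
  LinearMap.congr_fun (LinearMap.exists_leftInverse_of_injective X.incl
    (LinearMap.ker_eq_bot.2 X.incl_injective)).choose_spec v

theorem incl_retr {a : X.m} (ha : X.bnd a = 0) : X.incl (X.retr a) = a := by
  obtain ⟨v, rfl⟩ := (X.exact_left a).1 ha
  rw [retr_incl]

/-- The choices that go into the 3-cocycle of a crossed extension: a linear section `sec` of the
projection `n → q`, and an alternating bilinear map `lift` with values in `m` that lifts
`(x, y) ↦ [sec x, sec y] - sec [x, y]`. -/
structure Choice where
  sec : q →ₗ[k] X.n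
  proj_sec : ∀ x, X.proj (sec x) = x
  lift : twoCochain k q X.m
  bnd_lift : ∀ x y, X.bnd (lift x y) = ⁅sec x, sec y⁆ - sec ⁅x, y⁆

theorem nonempty_choice : Nonempty X.Choice := by
  obtain ⟨s, hs⟩ := LinearMap.exists_rightInverse_of_surjective (X.proj : X.n →ₗ[k] q)
    (LinearMap.range_eq_top.2 X.proj_surjective)
  have hs' : ∀ x, X.proj (s x) = x := fun x ↦ LinearMap.congr_fun hs x
  obtain ⟨t, ht⟩ := exists_quasiInverse (X.bnd : X.m →ₗ[k] X.n)
  refine ⟨⟨s, hs', ⟨LinearMap.mk₂ k (fun x y ↦ t (⁅s x, s y⁆ - s ⁅x, y⁆))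
    (fun a b c ↦ by rw [← map_add]; congr 1; simp only [map_add, add_lie]; abel)
    (fun t a b ↦ by rw [← map_smul]; congr 1; simp only [map_smul, smul_lie, smul_sub])
    (fun a b c ↦ by rw [← map_add]; congr 1; simp only [map_add, lie_add]; abel)
    (fun t a b ↦ by rw [← map_smul]; congr 1; simp only [map_smul, lie_smul, smul_sub]),
    fun x ↦ by simp⟩, fun x y ↦ ?_⟩⟩
  obtain ⟨a, ha⟩ := (X.exact_right (⁅s x, s y⁆ - s ⁅x, y⁆)).1
    (by rw [map_sub, LieHom.map_lie, hs', hs', hs', sub_self])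
  change X.bnd (t (⁅s x, s y⁆ - s ⁅x, y⁆)) = _
  rw [← ha]
  exact ht a

namespace Choice

variable {X} (C : X.Choice)

/-- The formal coboundary of `lift`. -/
def formal (x y z : q) : X.m :=
  X.act (C.sec x) (C.lift y z) - X.act (C.sec y) (C.lift x z) + X.act (C.sec z) (C.lift x y)
    - C.lift ⁅x, y⁆ z + C.lift ⁅x, z⁆ y - C.lift ⁅y, z⁆ x

theorem bnd_formal (x y z : q) : X.bnd (C.formal x y z) = 0 := by
  have e1 : ⁅⁅x, y⁆, z⁆ = ⁅x, ⁅y, z⁆⁆ - ⁅y, ⁅x, z⁆⁆ := lie_lie x y z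
  have e2 : ⁅⁅x, z⁆, y⁆ = - ⁅y, ⁅x, z⁆⁆ := (lie_skew _ _).symm
  have e3 : ⁅⁅y, z⁆, x⁆ = - ⁅x, ⁅y, z⁆⁆ := (lie_skew _ _).symm
  have a1 : ⁅C.sec z, ⁅C.sec x, C.sec y⁆⁆ =
      - (⁅C.sec x, ⁅C.sec y, C.sec z⁆⁆ - ⁅C.sec y, ⁅C.sec x, C.sec z⁆⁆) := by
    rw [← lie_lie, lie_skew]
  have a2 : ⁅C.sec ⁅x, y⁆, C.sec z⁆ = - ⁅C.sec z, C.sec ⁅x, y⁆⁆ := (lie_skew _ _).symm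
  have a3 : ⁅C.sec ⁅x, z⁆, C.sec y⁆ = - ⁅C.sec y, C.sec ⁅x, z⁆⁆ := (lie_skew _ _).symm
  have a4 : ⁅C.sec ⁅y, z⁆, C.sec x⁆ = - ⁅C.sec x, C.sec ⁅y, z⁆⁆ := (lie_skew _ _).symm
  simp only [formal, map_sub, map_add, X.bnd_act, C.bnd_lift, lie_sub, e1, e2, e3, a1, a2, a3, a4,
    map_neg]
  abel

/-- The alternating trilinear map `c` with `incl (c x y z) = formal x y z`. -/
noncomputable def cochain : threeCochain k q V :=
  ⟨{ toFun := fun x ↦ LinearMap.mk₂ k (fun y z ↦ X.retr (C.formal x y z))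
        (fun a b c ↦ by
          rw [← map_add]; congr 1
          simp only [formal, map_add, lie_add, add_lie, LinearMap.add_apply,
            LieDerivation.add_apply]; abel)
        (fun t a b ↦ by
          rw [← map_smul]; congr 1
          simp only [formal, map_smul, lie_smul, smul_lie, LinearMap.smul_apply,
            LieDerivation.smul_apply, smul_sub, smul_add])
        (fun a b c ↦ by
          rw [← map_add]; congr 1
          simp only [formal, map_add, lie_add, add_lie, LinearMap.add_apply,
            LieDerivation.add_apply]; abel)
        (fun t a b ↦ by
          rw [← map_smul]; congr 1
          simp only [formal, map_smul, lie_smul, smul_lie, LinearMap.smul_apply,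
            LieDerivation.smul_apply, smul_sub, smul_add])
     map_add' := fun a b ↦ by
        ext y z
        change X.retr _ = X.retr _ + X.retr _
        rw [← map_add]; congr 1
        simp only [formal, map_add, lie_add, add_lie, LinearMap.add_apply,
          LieDerivation.add_apply]; abel
     map_smul' := fun t a ↦ by
        ext y z
        change X.retr _ = t • X.retr _
        rw [← map_smul]; congr 1
        simp only [formal, map_smul, lie_smul, smul_lie, LinearMap.smul_apply,
          LieDerivation.smul_apply, smul_sub, smul_add] },
    by
      constructor
      · intro x y
        change X.retr (C.formal x x y) = 0
        simp [formal]
      · intro x y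
        change X.retr (C.formal x y y) = 0
        simp [formal]⟩

theorem incl_cochain (x y z : q) : X.incl (C.cochain.1 x y z) = C.formal x y z :=
  X.incl_retr (C.bnd_formal x y z)

theorem act_act (x y : q) (a : X.m) :
    X.act (C.sec y) (X.act (C.sec x) a) =
      X.act (C.sec x) (X.act (C.sec y) a) - X.act (C.sec ⁅x, y⁆) a - ⁅C.lift x y, a⁆ := by
  have h1 : ⁅C.sec x, C.sec y⁆ = X.bnd (C.lift x y) + C.sec ⁅x, y⁆ := by
    rw [C.bnd_lift, sub_add_cancel]
  have h2 : X.act ⁅C.sec x, C.sec y⁆ a =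
      X.act (C.sec x) (X.act (C.sec y) a) - X.act (C.sec y) (X.act (C.sec x) a) := by
    rw [LieHom.map_lie, LieDerivation.lie_apply]
  rw [h1, map_add, LieDerivation.add_apply, X.act_bnd] at h2
  rw [← sub_eq_zero, ← sub_eq_zero.2 h2]
  abel

/-- The 3-cocycle of a crossed extension, for given choices. -/
noncomputable def cocycle : threeCocycle k q V :=
  ⟨C.cochain, by
    refine LinearMap.mem_ker.2 ?_
    funext w x y z
    apply X.incl_injective
    change X.incl (⁅w, C.cochain.1 x y z⁆ - ⁅x, C.cochain.1 w y z⁆ + ⁅y, C.cochain.1 w x z⁆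
      - ⁅z, C.cochain.1 w x y⁆
      - C.cochain.1 ⁅w, x⁆ y z + C.cochain.1 ⁅w, y⁆ x z - C.cochain.1 ⁅w, z⁆ x y
      - C.cochain.1 ⁅x, y⁆ w z + C.cochain.1 ⁅x, z⁆ w y - C.cochain.1 ⁅y, z⁆ w x) = X.incl 0
    have key : ∀ (u : q) (v : V), X.incl ⁅u, v⁆ = X.act (C.sec u) (X.incl v) := fun u v ↦ by
      rw [X.act_incl, C.proj_sec]
    simp only [map_sub, map_add, key, C.incl_cochain, formal, map_zero]
    rw [C.act_act w x, C.act_act w y, C.act_act w z, C.act_act x y, C.act_act x z, C.act_act y z]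
    rw [← lie_skew (C.lift y z) (C.lift w x), ← lie_skew (C.lift x z) (C.lift w y),
      ← lie_skew (C.lift x y) (C.lift w z)]
    have sk : ∀ a b : q, C.lift a b = - C.lift b a := fun a b ↦ (twoCochain_skew C.lift b a).symm
    rw [sk ⁅y, z⁆ ⁅w, x⁆, sk ⁅x, z⁆ ⁅w, y⁆, sk ⁅x, y⁆ ⁅w, z⁆]
    have j1 : ∀ a b c : q, ⁅⁅b, c⁆, a⁆ = ⁅⁅a, c⁆, b⁆ - ⁅⁅a, b⁆, c⁆ := fun a b c ↦ by
      rw [lie_lie b c a, ← lie_skew b ⁅c, a⁆, ← lie_skew c a, ← lie_skew c ⁅b, a⁆, ← lie_skew b a]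
      simp only [neg_lie]
      abel
    simp only [j1 w x y, j1 w x z, j1 w y z, j1 x y z, map_add, map_sub, LinearMap.add_apply,
      LinearMap.sub_apply, map_zero, LinearMap.zero_apply]
    abel⟩

end Choice

/-- The class in `H³(q, V)` of a crossed extension: the class of the 3-cocycle obtained from any
choices. -/
noncomputable def cls : H3 k q V := (B3 k q V).mkQ X.nonempty_choice.some.cocycle

end CrossedExt
end Crossed

section Lambda
variable {k : Type*} [Field k] {g : Type*} [LieRing g] [LieAlgebra k g] {h : LieIdeal k g}
variable {M : Type*} [AddCommGroup M] [Module k M] [LieRingModule g M] [LieModule k g M]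
/-- The linear map `(z, m) ↦ ([x, z], x · m + d z)` of `M ⋊ h` given by `x : g`, `d : Der(h, M)`. -/
def derActFun (x : g) (d : LieDerivation k h M) : SemiProd k h M →ₗ[k] SemiProd k h M where
  toFun a := ⟨(⁅x, a.carrier.1⁆, ⁅x, a.carrier.2⁆ + d a.carrier.1)⟩
  map_add' a b := by
    rw [semiProd_add, semiProd_add]
    refine semiProd_ext (lie_add x a.carrier.1 b.carrier.1) ?_
    change ⁅x, a.carrier.2 + b.carrier.2⁆ + d (a.carrier.1 + b.carrier.1) =
      (⁅x, a.carrier.2⁆ + d a.carrier.1) + (⁅x, b.carrier.2⁆ + d b.carrier.1)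
    rw [lie_add, map_add]; abel
  map_smul' t a := by
    rw [semiProd_smul, semiProd_smul]
    refine semiProd_ext (lie_smul t x a.carrier.1) ?_
    change ⁅x, t • a.carrier.2⁆ + d (t • a.carrier.1) = t • (⁅x, a.carrier.2⁆ + d a.carrier.1)
    rw [lie_smul, map_smul, smul_add]

theorem derActFun_apply (x : g) (d : LieDerivation k h M) (a : SemiProd k h M) :
    derActFun x d a = ⟨(⁅x, a.carrier.1⁆, ⁅x, a.carrier.2⁆ + d a.carrier.1)⟩ := rfl


theorem derActFun_lie (x : g) (d : LieDerivation k h M) (a b : SemiProd k h M) :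
    derActFun x d ⁅a, b⁆ = ⁅a, derActFun x d b⁆ - ⁅b, derActFun x d a⁆ := by
  obtain ⟨⟨z, m⟩⟩ := a
  obtain ⟨⟨w, n⟩⟩ := b
  refine (congrArg (derActFun x d) (semiProd_lie _ _)).trans
    (Eq.trans ?_ (congrArg₂ (· - ·) (semiProd_lie _ _) (semiProd_lie _ _)).symm)
  refine semiProd_ext (Subtype.ext ?_) ?_
  · change ⁅x, ⁅(z : g), (w : g)⁆⁆ = ⁅(z : g), ⁅x, (w : g)⁆⁆ - ⁅(w : g), ⁅x, (z : g)⁆⁆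
    rw [leibniz_lie, ← lie_skew (w : g)]; abel
  · change ⁅x, ⁅(z : g), n⁆ - ⁅(w : g), m⁆⁆ + d ⁅z, w⁆ =
        (⁅(z : g), ⁅x, n⁆ + d w⁆ - ⁅⁅x, (w : g)⁆, m⁆) -
        (⁅(w : g), ⁅x, m⁆ + d z⁆ - ⁅⁅x, (z : g)⁆, n⁆)
    rw [LieDerivation.apply_lie_eq_sub]
    change ⁅x, ⁅(z : g), n⁆ - ⁅(w : g), m⁆⁆ + (⁅(z : g), d w⁆ - ⁅(w : g), d z⁆) = _
    simp only [lie_sub, lie_add, lie_lie]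
    abel
/-- `derActFun x d` is a derivation. -/
def derActAux (x : g) (d : LieDerivation k h M) :
    LieDerivation k (SemiProd k h M) (SemiProd k h M) where
  __ := derActFun x d
  leibniz' := derActFun_lie x d

theorem derActAux_apply (x : g) (d : LieDerivation k h M) (a : SemiProd k h M) :
    derActAux x d a = ⟨(⁅x, a.carrier.1⁆, ⁅x, a.carrier.2⁆ + d a.carrier.1)⟩ := rfl
variable (h M) in
/-- The action of `Der(h, M) ⋊ g` on `M ⋊ h`: `(x, d) · (z, m) = ([x, z], x · m + d z)`. -/
def derAct : SemiProd k g (LieDerivation k h M) →ₗ⁅k⁆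
    LieDerivation k (SemiProd k h M) (SemiProd k h M) where
  toFun e := derActAux e.carrier.1 e.carrier.2
  map_add' := by
    rintro ⟨x, d⟩ ⟨y, d'⟩
    refine LieDerivation.ext fun a ↦ semiProd_ext (add_lie x y a.carrier.1) ?_
    change ⁅x + y, a.carrier.2⁆ + (d a.carrier.1 + d' a.carrier.1) =
      (⁅x, a.carrier.2⁆ + d a.carrier.1) + (⁅y, a.carrier.2⁆ + d' a.carrier.1)
    rw [add_lie]; abel
  map_smul' := by
    rintro t ⟨x, d⟩
    refine LieDerivation.ext fun a ↦ semiProd_ext (smul_lie t x a.carrier.1) ?_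
    change ⁅t • x, a.carrier.2⁆ + t • d a.carrier.1 = t • (⁅x, a.carrier.2⁆ + d a.carrier.1)
    rw [smul_lie, smul_add]
  map_lie' := by
    rintro ⟨x, d⟩ ⟨y, d'⟩
    refine LieDerivation.ext fun a ↦ ?_
    obtain ⟨z, m⟩ := a
    refine (congrArg (fun e : SemiProd k g (LieDerivation k h M) ↦
      derActAux e.carrier.1 e.carrier.2 ⟨(z, m)⟩) (semiProd_lie ⟨(x, d)⟩ ⟨(y, d')⟩)).trans
      (Eq.trans ?_ (LieDerivation.lie_apply (derActAux x d) (derActAux y d') ⟨(z, m)⟩).symm)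
    refine semiProd_ext (Subtype.ext ?_) ?_
    · exact lie_lie x y (z : g)
    · change ⁅⁅x, y⁆, m⁆ + ((⁅x, d' z⁆ - d' ⁅x, z⁆) - (⁅y, d z⁆ - d ⁅y, z⁆)) =
        (⁅x, ⁅y, m⁆ + d' z⁆ + d ⁅y, z⁆) - (⁅y, ⁅x, m⁆ + d z⁆ + d' ⁅x, z⁆)
      rw [lie_lie, lie_add, lie_add]; abel

theorem pairs_lie_mem (D : LieDerivation k (g ⧸ h) (H1 k h M)) (x y : g)
    (d d' : LieDerivation k h M)
    (hx : D (LieSubmodule.Quotient.mk x) = (Inn k h M).mkQ d)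
    (hy : D (LieSubmodule.Quotient.mk y) = (Inn k h M).mkQ d') :
    D (LieSubmodule.Quotient.mk ⁅x, y⁆) = (Inn k h M).mkQ (⁅x, d'⁆ - ⁅y, d⁆) := by
  rw [LieSubmodule.Quotient.mk_bracket, LieDerivation.apply_lie_eq_sub, hx, hy, mk_lie_mk,
    mk_lie_mk, map_sub]
theorem pairs_smul_mem (D : LieDerivation k (g ⧸ h) (H1 k h M)) (t : k) (x : g)
    (d : LieDerivation k h M)
    (hx : D (LieSubmodule.Quotient.mk x) = (Inn k h M).mkQ d) :
    D (LieSubmodule.Quotient.mk (t • x)) = (Inn k h M).mkQ (t • d) := by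
  change D (t • (LieSubmodule.Quotient.mk x : g ⧸ h)) = _
  rw [map_smul, map_smul, hx]

/-- The subalgebra of `Der(h, M) ⋊ g` of all pairs `(x, d)` with `D [x] = [d]`. -/
def pairs (D : LieDerivation k (g ⧸ h) (H1 k h M)) :
    LieSubalgebra k (SemiProd k g (LieDerivation k h M)) where
  carrier := {e | D (LieSubmodule.Quotient.mk e.carrier.1) = (Inn k h M).mkQ e.carrier.2}
  add_mem' {a b} ha hb := by
    change D (LieSubmodule.Quotient.mk a.carrier.1 + LieSubmodule.Quotient.mk b.carrier.1) =
      (Inn k h M).mkQ (a.carrier.2 + b.carrier.2)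
    rw [map_add, map_add, ha, hb]
  zero_mem' := by
    change D 0 = (Inn k h M).mkQ 0
    rw [map_zero, map_zero]
  smul_mem' t a ha := pairs_smul_mem D t a.carrier.1 a.carrier.2 ha
  lie_mem' {a b} ha hb := by
    rw [semiProd_lie a b]
    exact pairs_lie_mem D a.carrier.1 b.carrier.1 a.carrier.2 b.carrier.2 ha hb

variable (h M) in
/-- The Lie algebra map `M ⋊ h → Der(h, M) ⋊ g`, `(z, m) ↦ (z, -δ m)`. -/
def bndAux : SemiProd k h M →ₗ⁅k⁆ SemiProd k g (LieDerivation k h M) where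
  toFun a := ⟨((a.carrier.1 : g), -LieDerivation.inner k h M a.carrier.2)⟩
  map_add' a b := semiProd_ext rfl (by
    change -LieDerivation.inner k h M (a.carrier.2 + b.carrier.2) =
      -LieDerivation.inner k h M a.carrier.2 + -LieDerivation.inner k h M b.carrier.2
    rw [map_add, neg_add])
  map_smul' t a := semiProd_ext rfl (by
    change -LieDerivation.inner k h M (t • a.carrier.2) =
      t • -LieDerivation.inner k h M a.carrier.2
    rw [map_smul, smul_neg])
  map_lie' := by
    rintro ⟨z, m⟩ ⟨w, n⟩
    refine (congrArg (fun a : SemiProd k h M ↦ (⟨((a.carrier.1 : g),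
      -LieDerivation.inner k h M a.carrier.2)⟩ : SemiProd k g (LieDerivation k h M)))
      (semiProd_lie ⟨(z, m)⟩ ⟨(w, n)⟩)).trans (Eq.trans ?_ (semiProd_lie _ _).symm)
    refine semiProd_ext rfl ?_
    change -LieDerivation.inner k h M (⁅(z : g), n⁆ - ⁅(w : g), m⁆) =
      ⁅(z : g), -LieDerivation.inner k h M n⁆ - ⁅(w : g), -LieDerivation.inner k h M m⁆
    rw [lie_neg, lie_neg, lie_inner, lie_inner, map_sub]; abel

theorem bndAux_mem (D : LieDerivation k (g ⧸ h) (H1 k h M)) (a : SemiProd k h M) :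
    bndAux h M a ∈ pairs D := by
  change D (LieSubmodule.Quotient.mk (a.carrier.1 : g)) =
    (Inn k h M).mkQ (-LieDerivation.inner k h M a.carrier.2)
  rw [(LieSubmodule.Quotient.mk_eq_zero' (N := h)).2 a.carrier.1.2, map_zero]
  exact ((Submodule.Quotient.mk_eq_zero _).2 (neg_mem (LinearMap.mem_range_self _ _))).symm

theorem bndAux_derAct (e : SemiProd k g (LieDerivation k h M)) (a : SemiProd k h M) :
    bndAux h M (derAct h M e a) = ⁅e, bndAux h M a⁆ := by
  obtain ⟨x, d⟩ := e
  obtain ⟨z, m⟩ := a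
  refine Eq.trans ?_ (semiProd_lie _ _).symm
  refine semiProd_ext rfl ?_
  change -LieDerivation.inner k h M (⁅x, m⁆ + d z) =
    ⁅x, -LieDerivation.inner k h M m⁆ - ⁅(z : g), d⁆
  rw [lie_mem_der, lie_neg, lie_inner, map_add]; abel

theorem derAct_bndAux (a b : SemiProd k h M) : derAct h M (bndAux h M a) b = ⁅a, b⁆ := by
  obtain ⟨z, m⟩ := a
  obtain ⟨w, n⟩ := b
  refine Eq.trans ?_ (semiProd_lie _ _).symm
  refine semiProd_ext rfl ?_
  change ⁅(z : g), n⁆ + -⁅(w : g), m⁆ = ⁅(z : g), n⁆ - ⁅(w : g), m⁆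
  rw [sub_eq_add_neg]

theorem bndAux_eq_zero (a : SemiProd k h M) :
    bndAux h M a = 0 ↔ ∃ v : invariants h M, (⟨(0, (v : M))⟩ : SemiProd k h M) = a := by
  obtain ⟨z, m⟩ := a
  constructor
  · intro ha
    have h1 : (z : g) = 0 := congrArg (fun e : SemiProd k g (LieDerivation k h M) ↦ e.carrier.1) ha
    have h2 : -LieDerivation.inner k h M m = 0 :=
      congrArg (fun e : SemiProd k g (LieDerivation k h M) ↦ e.carrier.2) ha
    exact ⟨⟨m, fun w ↦ LieDerivation.congr_fun (neg_eq_zero.1 h2) w⟩,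
      semiProd_ext (Subtype.ext h1.symm) rfl⟩
  · rintro ⟨v, hv⟩
    rw [← hv]
    refine semiProd_ext rfl ?_
    change -LieDerivation.inner k h M (v : M) = 0
    rw [neg_eq_zero]
    exact LieDerivation.ext fun w ↦ v.2 w

theorem exists_bndAux (D : LieDerivation k (g ⧸ h) (H1 k h M))
    (e : SemiProd k g (LieDerivation k h M))
    (he : D (LieSubmodule.Quotient.mk e.carrier.1) = (Inn k h M).mkQ e.carrier.2)
    (h0 : (LieSubmodule.Quotient.mk e.carrier.1 : g ⧸ h) = 0) : ∃ a, bndAux h M a = e := by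
  have hxh : e.carrier.1 ∈ h := (LieSubmodule.Quotient.mk_eq_zero' (N := h)).1 h0
  rw [h0, map_zero] at he
  obtain ⟨m, hm⟩ := (Submodule.Quotient.mk_eq_zero _).1 he.symm
  refine ⟨⟨(⟨e.carrier.1, hxh⟩, -m)⟩, semiProd_ext rfl ?_⟩
  change -LieDerivation.inner k h M (-m) = e.carrier.2
  rw [map_neg, neg_neg, hm]

theorem derAct_incl (e : SemiProd k g (LieDerivation k h M)) (m : M) :
    derAct h M e ⟨(0, m)⟩ = ⟨(0, ⁅e.carrier.1, m⁆)⟩ := by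
  refine semiProd_ext (lie_zero _) ?_
  change ⁅e.carrier.1, m⁆ + e.carrier.2 0 = ⁅e.carrier.1, m⁆
  rw [map_zero, add_zero]

/-- The projection `(x, d) ↦ [x]` of `pairs D` onto `g / h`. -/
def pairsProj (D : LieDerivation k (g ⧸ h) (H1 k h M)) : pairs D →ₗ⁅k⁆ g ⧸ h where
  toFun e := LieSubmodule.Quotient.mk e.1.carrier.1
  map_add' _ _ := rfl
  map_smul' _ _ := rfl
  map_lie' := rfl

/-- The map `(z, m) ↦ (z, -δ m)` from `M ⋊ h` to `pairs D`. -/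
def pairsBnd (D : LieDerivation k (g ⧸ h) (H1 k h M)) : SemiProd k h M →ₗ⁅k⁆ pairs D where
  toFun a := ⟨bndAux h M a, bndAux_mem D a⟩
  map_add' a b := Subtype.ext (map_add (bndAux h M) a b)
  map_smul' t a := Subtype.ext (map_smul (bndAux h M) t a)
  map_lie' {a b} := Subtype.ext ((bndAux h M).map_lie a b)

theorem pairsProj_eq_zero (D : LieDerivation k (g ⧸ h) (H1 k h M)) (e : pairs D) :
    pairsProj D e = 0 ↔ ∃ a, pairsBnd D a = e := by
  constructor
  · intro h0
    refine (exists_bndAux D e.1 e.2 h0).imp fun a ha ↦ Subtype.ext ha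
  · rintro ⟨a, rfl⟩
    exact (LieSubmodule.Quotient.mk_eq_zero' (N := h)).2 a.carrier.1.2

theorem mem_pairs (D : LieDerivation k (g ⧸ h) (H1 k h M)) (x : g) (d : LieDerivation k h M)
    (hd : (Inn k h M).mkQ d = D (LieSubmodule.Quotient.mk x)) :
    (⟨(x, d)⟩ : SemiProd k g (LieDerivation k h M)) ∈ pairs D := hd.symm

theorem pairsProj_surjective (D : LieDerivation k (g ⧸ h) (H1 k h M)) :
    Function.Surjective (pairsProj D) := by
  intro y
  refine y.inductionOn' fun x ↦ ?_
  exact ((Inn k h M).mkQ_surjective (D (LieSubmodule.Quotient.mk x))).elim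
    fun d hd ↦ ⟨⟨⟨(x, d)⟩, mem_pairs D x d hd⟩, rfl⟩

variable (h M) in
/-- The inclusion `m ↦ (0, m)` of `M^h` into `M ⋊ h`. -/
def invIncl : invariants h M →ₗ[k] SemiProd k h M where
  toFun m := ⟨(0, m)⟩
  map_add' _ _ := semiProd_ext (add_zero _).symm rfl
  map_smul' _ _ := semiProd_ext (smul_zero _).symm rfl

theorem invIncl_injective : Function.Injective (invIncl h M) := fun _ _ hab ↦
  Subtype.ext (congrArg (fun e : SemiProd k h M ↦ e.carrier.2) hab)

/-- The crossed extension `0 → M^h → M ⋊ h → p → g / h → 0` given by a derivation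
`D : g / h → H¹(h, M)`, where `p = pairs D` and `M ⋊ h → p` is `(z, m) ↦ (z, -δ m)`. -/
def crossedOf (D : LieDerivation k (g ⧸ h) (H1 k h M)) :
    CrossedExt k (g ⧸ h) (invariants h M) where
  m := SemiProd k h M
  n := pairs D
  act := (derAct h M).comp (pairs D).incl
  bnd := pairsBnd D
  incl := invIncl h M
  proj := pairsProj D
  bnd_act e a := Subtype.ext (bndAux_derAct e.1 a)
  act_bnd a b := derAct_bndAux a b
  incl_injective := invIncl_injective
  exact_left a := Subtype.ext_iff.trans (bndAux_eq_zero a)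
  exact_right := pairsProj_eq_zero D
  proj_surjective := pairsProj_surjective D
  act_incl e v := derAct_incl e.1 (v : M)

/-- The class in `H³(g / h, M^h)` of the crossed extension given by `D`. -/
noncomputable def lamHat (D : LieDerivation k (g ⧸ h) (H1 k h M)) :
    H3 k (g ⧸ h) (invariants h M) :=
  (crossedOf D).cls

/-- The map `λ : H¹(g / h, H¹(h, M)) → H³(g / h, M^h)` induced by `lamHat`. -/
noncomputable def lam (ξ : H1 k (g ⧸ h) (H1 k h M)) : H3 k (g ⧸ h) (invariants h M) :=
  lamHat ((Inn k (g ⧸ h) (H1 k h M)).mkQ_surjective ξ).choose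

/-- `f_α(x, y) = [α x, α y] - α [x, y] ∈ h` for a linear section `α` of `g → g / h`. -/
def defect (α : (g ⧸ h) →ₗ[k] g) (hα : ∀ x, (LieSubmodule.Quotient.mk (α x) : g ⧸ h) = x)
    (x y : g ⧸ h) : h :=
  ⟨⁅α x, α y⁆ - α ⁅x, y⁆, by
    rw [← LieSubmodule.Quotient.mk_eq_zero' (N := h)]
    change (LieSubmodule.Quotient.mk ⁅α x, α y⁆ : g ⧸ h) -
      LieSubmodule.Quotient.mk (α ⁅x, y⁆) = 0
    rw [LieSubmodule.Quotient.mk_bracket, hα, hα, hα, sub_self]⟩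

end Lambda
end LieSeq

open LieSeq LieModule.Cohomology

/-! Each of the three classes comes from an extension, a partial splitting or a crossed extension,
and its definition hides arbitrary choices. The method is to show that the class may be computed
with any choice, and then to make the choice dictated by `α`, for which the cocycle can be read off.

For tr, (m, x) lies in the idealizer of the graph of d exactly when ˣd = δ(m). Hence x ↦ (η(x),
α(x)) takes values in I as soon as δ(η(x)) is the derivation obtained by letting α(x) act on d. It
induces a section of I/s_d(h), and the bracket defect of that section, corrected by an element of
s_d(h) so that it falls into M, is the formula of `trHat_eq`. A section s with values in I gives
such an η, namely the M-component of s ∘ α, and the formula in terms of s follows by comparison.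

For ρ, every partial splitting of M ×_f g is the graph of a linear map γ
(`PartialSplitting.exists_gamma`), and (0, α(x)) is a lift of x on which d_e is computed directly.

For λ, a linear lift r of D gives the section x ↦ (r(x), α(x)) of p, whose curvature is the image of
(-F, f_α). The M-component of the resulting 3-cocycle is c (`lamHat_eq`).

Independence of the representatives comes from the same formulas. Changing d by δ(m), or D by the
inner derivation of [e], can be matched by a change of η, or of r and F, that leaves the cocycle
itself unaltered (`trHat_congr`, `lamHat_eq_of_add`). For ρ, a change of f and γ alters the
derivation by an inner one (`rhoHat_congr`). -/

namespace LieSeq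

universe u v w

/-! ### Independence of the section for the class of an extension. -/

section Extensions

variable {k : Type*} [Field k] {L : Type*} [LieRing L] [LieAlgebra k L]
variable {V : Type*} [AddCommGroup V] [Module k V] [LieRingModule L V] [LieModule k L V]

/-- The class of an extension may be computed with any linear section. -/
theorem ModExt.cls_eq (X : ModExt.{w} k L V) (s : L →ₗ[k] X.E) (hs : ∀ x, X.proj (s x) = x) :
    X.cls = (B2 k L V).mkQ (X.cocycle s hs) := by
  unfold ModExt.cls
  set t := X.exists_section.choose
  have ht : ∀ x, X.proj (t x) = x := X.exists_section.choose_spec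
  refine (Submodule.Quotient.eq _).2 ⟨X.retr ∘ₗ (t - s), ?_⟩
  have key : ∀ x, X.incl (X.retr (t x - s x)) = t x - s x := fun x ↦
    X.incl_retr (by rw [map_sub, hs, ht, sub_self])
  refine Subtype.ext (LinearMap.ext fun x ↦ LinearMap.ext fun y ↦ X.incl_injective ?_)
  change X.incl (⁅x, X.retr (t y - s y)⁆ - ⁅y, X.retr (t x - s x)⁆
    - X.retr (t ⁅x, y⁆ - s ⁅x, y⁆)) = X.incl (X.cochain t x y - X.cochain s x y)
  have h1 : ∀ (x : L) (v : V), X.incl ⁅x, v⁆ = ⁅s x, X.incl v⁆ := fun x v ↦ by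
    rw [X.lie_incl, hs]
  have h2 : ∀ (x : L) (v : V), X.incl ⁅x, v⁆ = ⁅t x, X.incl v⁆ := fun x v ↦ by
    rw [X.lie_incl, ht]
  -- The action on V is computed through t in one term and through s in the other, because [t x, t
  -- y] - [s x, s y] = [t x, (t - s) y] - [s y, (t - s) x]. No quadratic term in t - s is left over.
  rw [map_sub X.incl, map_sub X.incl, map_sub X.incl, X.incl_cochain t ht, X.incl_cochain s hs, h2 x, h1 y, key, key,
    key, ← lie_skew (s y)]
  simp only [lie_sub, sub_lie]
  rw [← lie_skew (s x) (s y), ← lie_skew (t x) (s y)]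
  abel

end Extensions

/-! ### Independence of the section and the lift for the class of a crossed extension. -/

section Crossed

variable {k : Type*} [Field k] {q : Type*} [LieRing q] [LieAlgebra k q]
variable {V : Type*} [AddCommGroup V] [Module k V] [LieRingModule q V] [LieModule k q V]

namespace CrossedExt

variable {X : CrossedExt.{u, v} k q V}

/-- Two choices of a lift over the same section give cohomologous 3-cocycles. -/
theorem Choice.mkQ_cocycle_of_sec_eq (C C' : X.Choice) (hsec : C.sec = C'.sec) :
    (B3 k q V).mkQ C.cocycle = (B3 k q V).mkQ C'.cocycle := by
  have key : ∀ x y, X.incl (X.retr (C.lift x y - C'.lift x y)) = C.lift x y - C'.lift x y :=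
    fun x y ↦ X.incl_retr (by rw [map_sub, C.bnd_lift, C'.bnd_lift, hsec, sub_self])
  refine (Submodule.Quotient.eq _).2 ⟨⟨(C.lift.1 - C'.lift.1).compr₂ X.retr, fun x ↦ ?_⟩, ?_⟩
  · change X.retr (C.lift x x - C'.lift x x) = 0
    rw [twoCochain_alt, twoCochain_alt, sub_self, map_zero]
  · refine LinearMap.ext fun x ↦ LinearMap.ext fun y ↦ LinearMap.ext fun z ↦ X.incl_injective ?_
    change X.incl (⁅x, X.retr (C.lift y z - C'.lift y z)⁆ - ⁅y, X.retr (C.lift x z - C'.lift x z)⁆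
      + ⁅z, X.retr (C.lift x y - C'.lift x y)⁆ - X.retr (C.lift ⁅x, y⁆ z - C'.lift ⁅x, y⁆ z)
      + X.retr (C.lift ⁅x, z⁆ y - C'.lift ⁅x, z⁆ y)
      - X.retr (C.lift ⁅y, z⁆ x - C'.lift ⁅y, z⁆ x)) =
        X.incl (C.cochain.1 x y z - C'.cochain.1 x y z)
    have h1 : ∀ (x : q) (v : V), X.incl ⁅x, v⁆ = X.act (C.sec x) (X.incl v) := fun x v ↦ by
      rw [X.act_incl, C.proj_sec]
    simp only [map_sub X.incl, map_add X.incl, h1, key, C.incl_cochain, C'.incl_cochain, formal,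
      ← hsec]
    simp only [map_sub]
    abel

/-- The lift over the section `sec + bnd ∘ u` obtained from a lift over `sec`. -/
def Choice.translate (C : X.Choice) (u : q →ₗ[k] X.m) : X.Choice where
  sec := C.sec + (X.bnd : X.m →ₗ[k] X.n) ∘ₗ u
  proj_sec x := by
    change X.proj (C.sec x + X.bnd (u x)) = x
    rw [map_add, C.proj_sec, (X.exact_right _).2 ⟨_, rfl⟩, add_zero]
  lift := C.lift + ⟨LinearMap.mk₂ k
    -- This is the change of the curvature under sec ↦ sec + ∂u, pulled back through ∂ by
    -- equivariance.
    (fun x y ↦ X.act (C.sec x) (u y) - X.act (C.sec y) (u x) + ⁅u x, u y⁆ - u ⁅x, y⁆)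
    (fun a b c ↦ by simp only [map_add, LieDerivation.add_apply, add_lie]; abel)
    (fun t a b ↦ by
      simp only [map_smul, LieDerivation.smul_apply, smul_lie, smul_sub, smul_add])
    (fun a b c ↦ by simp only [map_add, LieDerivation.add_apply, lie_add]; abel)
    (fun t a b ↦ by
      simp only [map_smul, LieDerivation.smul_apply, lie_smul, smul_sub, smul_add]),
    fun x ↦ by simp⟩
  bnd_lift x y := by
    change X.bnd (C.lift x y + (X.act (C.sec x) (u y) - X.act (C.sec y) (u x) + ⁅u x, u y⁆
      - u ⁅x, y⁆)) = ⁅C.sec x + X.bnd (u x), C.sec y + X.bnd (u y)⁆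
        - (C.sec ⁅x, y⁆ + X.bnd (u ⁅x, y⁆))
    simp only [map_add, map_sub, C.bnd_lift, X.bnd_act, LieHom.map_lie, lie_add, add_lie]
    rw [← lie_skew (X.bnd (u x)) (C.sec y)]
    abel

theorem Choice.translate_lift (C : X.Choice) (u : q →ₗ[k] X.m) (x y : q) :
    (C.translate u).lift x y = C.lift x y + (X.act (C.sec x) (u y) - X.act (C.sec y) (u x)
      + ⁅u x, u y⁆ - u ⁅x, y⁆) := rfl

theorem Choice.translate_act (C : X.Choice) (u : q →ₗ[k] X.m) (x : q) (a : X.m) :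
    X.act ((C.translate u).sec x) a = X.act (C.sec x) a + ⁅u x, a⁆ := by
  change X.act (C.sec x + X.bnd (u x)) a = _
  rw [map_add, LieDerivation.add_apply, X.act_bnd]

/-- The cocycle is unchanged on the nose, not merely up to a coboundary. The operators `X.act (C.sec
x)` fail to represent q by bracketing with `C.lift` (`act_act`), and this failure cancels the
brackets of u with `C.lift` that the translated action produces. The terms quadratic in u cancel in
pairs, and the cubic ones vanish by the Jacobi identity. -/
theorem Choice.translate_formal (C : X.Choice) (u : q →ₗ[k] X.m) (x y z : q) :
    (C.translate u).formal x y z = C.formal x y z := by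
  simp only [formal, translate_lift, translate_act, map_add, map_sub, lie_add,
    LieDerivation.apply_lie_eq_sub]
  rw [C.act_act x y, C.act_act x z, C.act_act y z]
  have e1 : ⁅⁅x, y⁆, z⁆ = ⁅x, ⁅y, z⁆⁆ - ⁅y, ⁅x, z⁆⁆ := lie_lie x y z
  have e2 : ⁅⁅x, z⁆, y⁆ = - ⁅y, ⁅x, z⁆⁆ := (lie_skew _ _).symm
  have e3 : ⁅⁅y, z⁆, x⁆ = - ⁅x, ⁅y, z⁆⁆ := (lie_skew _ _).symm
  have a2 : ⁅u x, ⁅u z, u y⁆⁆ = ⁅u y, ⁅u z, u x⁆⁆ - ⁅u z, ⁅u y, u x⁆⁆ := by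
    rw [← lie_skew (u x), lie_lie, neg_sub]
  have sk1 : ∀ a b c : q, ⁅C.lift a b, u c⁆ = - ⁅u c, C.lift a b⁆ := fun _ _ _ ↦
    (lie_skew _ _).symm
  have sk2 : ∀ a b c : q, ⁅u ⁅a, b⁆, u c⁆ = - ⁅u c, u ⁅a, b⁆⁆ := fun _ _ _ ↦ (lie_skew _ _).symm
  simp only [sk1, sk2, ← lie_skew (u x) (u y), ← lie_skew (u x) (u z), ← lie_skew (u y) (u z)]
  simp only [e1, e2, e3, a2, map_sub, map_neg, lie_neg]
  abel

/-- The class of a crossed extension may be computed with any choices. -/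
theorem cls_eq (C : X.Choice) : X.cls = (B3 k q V).mkQ C.cocycle := by
  unfold cls
  generalize X.nonempty_choice.some = C'
  obtain ⟨t, ht⟩ := exists_quasiInverse (X.bnd : X.m →ₗ[k] X.n)
  -- Two sections differ by a map into the image of ∂, on which t is a right inverse of ∂.
  -- Translating C by this difference therefore reaches the section of C', and only the lifts remain
  -- to be compared.
  have h1 : (C.translate (t ∘ₗ (C'.sec - C.sec))).sec = C'.sec := by
    refine LinearMap.ext fun x ↦ ?_
    change C.sec x + X.bnd (t (C'.sec x - C.sec x)) = C'.sec x
    obtain ⟨a, ha⟩ := (X.exact_right (C'.sec x - C.sec x)).1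
      (by rw [map_sub, C.proj_sec, C'.proj_sec, sub_self])
    have := ht a
    change X.bnd (t (X.bnd a)) = X.bnd a at this
    rw [← ha, this, ha, add_sub_cancel]
  rw [Choice.mkQ_cocycle_of_sec_eq _ _ h1.symm]
  congr 1
  refine Subtype.ext (Subtype.ext (LinearMap.ext fun x ↦ LinearMap.ext fun y ↦
    LinearMap.ext fun z ↦ X.incl_injective ?_))
  exact ((Choice.incl_cochain _ x y z).trans (C.translate_formal _ x y z)).trans
    (C.incl_cochain x y z).symm

end CrossedExt
end Crossed

/-! ### The map tr: sections of the idealizer and explicit 2-cocycles. -/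

section TrRho

variable {k : Type*} [Field k] {g : Type*} [LieRing g] [LieAlgebra k g] {h : LieIdeal k g}
variable {M : Type*} [AddCommGroup M] [Module k M] [LieRingModule g M] [LieModule k g M]

/-- An element e normalizes the graph of d if and only if d_e = 0, and `sd_der` computes d_e. -/
theorem mem_idealizer_sd_iff (d : LieDerivation k h M) (e : SemiProd k g M) :
    e ∈ (sd d).idealizer ↔ ⁅e.carrier.1, d⁆ = LieDerivation.inner k h M e.carrier.2 := by
  refine ((sd d).mem_idealizer_iff e).trans ?_
  rw [← sub_eq_zero, ← sd_der]
  constructor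
  · intro H
    refine LieDerivation.ext fun z ↦ (twistedExt (0 : twoCocycle k g M)).incl_injective ?_
    refine ((sd d).incl_der e z).trans ?_
    rw [H z, sub_self]
    exact (map_zero _).symm
  · intro H z
    refine sub_eq_zero.1 (((sd d).incl_der e z).symm.trans ?_)
    rw [H]
    exact map_zero _

/-- If every `φ x` is inner, then
`φ x = δ (η x)` for a linear map `η`. -/
theorem exists_linear_inner {A : Type*} [AddCommGroup A] [Module k A]
    (φ : A →ₗ[k] LieDerivation k h M) (hφ : ∀ x, φ x ∈ Inn k h M) :
    ∃ η : A →ₗ[k] M, ∀ x, φ x = LieDerivation.inner k h M (η x) := by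
  obtain ⟨t, ht⟩ := exists_quasiInverse (LieDerivation.inner k h M)
  refine ⟨t ∘ₗ φ, fun x ↦ ?_⟩
  obtain ⟨m, hm⟩ := hφ x
  rw [LinearMap.comp_apply, ← hm, ht]

theorem lie_mem_inn_of_invariant (d : LieDerivation k h M) (hd : (Inn k h M).mkQ d ∈ H1inv k h M)
    (x : g) : ⁅x, d⁆ ∈ Inn k h M := by
  have := (LieModule.mem_maxTrivSubmodule k (g ⧸ h) (H1 k h M) _).1 hd
    (LieSubmodule.Quotient.mk x)
  rw [mk_lie_mk] at this
  exact (Submodule.Quotient.mk_eq_zero _).1 this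

variable (α : (g ⧸ h) →ₗ[k] g) (hα : ∀ x, (LieSubmodule.Quotient.mk (α x) : g ⧸ h) = x)

/-- Invariance of [d] makes each of these derivations inner; a linear quasi-inverse of δ selects the
primitives linearly in x. -/
theorem exists_eta (d : LieDerivation k h M) (hd : (Inn k h M).mkQ d ∈ H1inv k h M) :
    ∃ η : (g ⧸ h) →ₗ[k] M, ∀ x, ⁅α x, d⁆ = LieDerivation.inner k h M (η x) :=
  exists_linear_inner
    { toFun := fun x ↦ ⁅α x, d⁆
      map_add' := fun x y ↦ by rw [map_add, add_lie]
      map_smul' := fun t x ↦ by rw [map_smul, smul_lie, RingHom.id_apply] }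
    fun x ↦ lie_mem_inn_of_invariant d hd (α x)

/-- The section `x ↦ (α x, η x)` of `M ⋊ g` with values in the idealizer of `s_d(h)`. -/
def idealizerSection (d : LieDerivation k h M) (η : (g ⧸ h) →ₗ[k] M)
    (hη : ∀ x, ⁅α x, d⁆ = LieDerivation.inner k h M (η x)) :
    (g ⧸ h) →ₗ[k] (sd d).idealizer where
  toFun x := ⟨(⟨(α x, η x)⟩ : SemiProd k g M), (mem_idealizer_sd_iff d _).2 (hη x)⟩
  map_add' x y := Subtype.ext (semiProd_ext (map_add α x y) (map_add η x y))
  map_smul' t x := Subtype.ext (semiProd_ext (map_smul α t x) (map_smul η t x))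

/-- The class `trHat d` is represented by an explicit cocycle. -/
theorem trHat_eq (d : LieDerivation k h M) (hd : (Inn k h M).mkQ d ∈ H1inv k h M)
    (η : (g ⧸ h) →ₗ[k] M) (hη : ∀ x, ⁅α x, d⁆ = LieDerivation.inner k h M (η x)) :
    ∃ F : twoCocycle k (g ⧸ h) (invariants h M),
      (∀ x y, (F.1 x y : M) = ⁅α x, η y⁆ - ⁅α y, η x⁆ - η ⁅x, y⁆ - d (defect α hα x y)) ∧
      trHat d hd = (B2 k (g ⧸ h) (invariants h M)).mkQ F := by
  let X := (sd d).omega (sd_der_mem_inn d hd)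
  let σ' := idealizerSection α d η hη
  let σ : (g ⧸ h) →ₗ[k] X.E :=
    (LieSubmodule.Quotient.mk' (sd d).image :
      (sd d).idealizer →ₗ[k] (sd d).idealizer ⧸ (sd d).image) ∘ₗ σ'
  have hσ : ∀ x, X.proj (σ x) = x := hα
  refine ⟨X.cocycle σ hσ, fun x y ↦ ?_, X.cls_eq σ hσ⟩
  have h1 := X.incl_cochain σ hσ x y
  -- The cocycle is known only modulo s_d(h), so it differs from the bracket defect upstairs by some
  -- (d(z), z). The g-component forces z = -f_α(x, y), and the M-component is then the formula.
  have h2 := (Submodule.Quotient.eq (sd d).image.toSubmodule).1 h1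
  obtain ⟨z, hz⟩ := ((sd d).mem_image _).1 h2
  have hz' : (⟨((z : g), d z)⟩ : SemiProd k g M) =
      (⟨(0, (X.cochain σ x y : M))⟩ : SemiProd k g M) -
        (⁅(⟨(α x, η x)⟩ : SemiProd k g M), ⟨(α y, η y)⟩⁆ - ⟨(α ⁅x, y⁆, η ⁅x, y⁆)⟩) := hz
  rw [semiProd_lie] at hz'
  have c1 : (z : g) = 0 - (⁅α x, α y⁆ - α ⁅x, y⁆) := congrArg (fun e ↦ e.carrier.1) hz'
  have c2 : d z = (X.cochain σ x y : M) - (⁅α x, η y⁆ - ⁅α y, η x⁆ - η ⁅x, y⁆) :=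
    congrArg (fun e ↦ e.carrier.2) hz'
  have hzd : z = - defect α hα x y := Subtype.ext (c1.trans (zero_sub _))
  rw [hzd, map_neg] at c2
  change (X.cochain σ x y : M) = _
  rw [sub_eq_add_neg _ (d _), c2, add_sub_cancel]

-- When d is replaced by d + δ(m), η may be replaced by x ↦ η(x) + α(x)·m. The new terms in the
-- explicit cocycle are α(x)·(α(y)·m) - α(y)·(α(x)·m) - α[x,y]·m - f_α(x,y)·m = 0, so both classes
-- have the same representative.
include hα in
theorem trHat_congr (d d' : LieDerivation k h M) (hd : (Inn k h M).mkQ d ∈ H1inv k h M)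
    (hd' : (Inn k h M).mkQ d' ∈ H1inv k h M) (hdd : (Inn k h M).mkQ d' = (Inn k h M).mkQ d) :
    trHat d' hd' = trHat d hd := by
  obtain ⟨m, hm⟩ := (Submodule.Quotient.eq _).1 hdd
  obtain rfl : d' = d + LieDerivation.inner k h M m := by rw [hm, add_sub_cancel]
  obtain ⟨η, hη⟩ := exists_eta α d hd
  let η' : (g ⧸ h) →ₗ[k] M := η + (LieModule.toEnd k g M : g →ₗ[k] Module.End k M).flip m ∘ₗ α
  have h1 : ∀ x, η' x = η x + ⁅α x, m⁆ := fun _ ↦ rfl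
  obtain ⟨F, hF, hF'⟩ := trHat_eq α hα d hd η hη
  obtain ⟨G, hG, hG'⟩ := trHat_eq α hα _ hd' η' fun x ↦ by
    rw [lie_add, hη, lie_inner, h1, map_add]
  rw [hF', hG']
  congr 1
  refine Subtype.ext (Subtype.ext (LinearMap.ext fun x ↦ LinearMap.ext fun y ↦ Subtype.ext ?_))
  refine (hG x y).trans (Eq.trans ?_ (hF x y).symm)
  have h2 : LieDerivation.inner k h M m (defect α hα x y) = ⁅⁅α x, α y⁆ - α ⁅x, y⁆, m⁆ := rfl
  rw [h1, h1, h1, LieDerivation.add_apply, h2]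
  simp only [lie_add, sub_lie, lie_lie]
  abel

include hα in
theorem tr_mk (d : LieDerivation k h M) (hd : (Inn k h M).mkQ d ∈ H1inv k h M) :
    tr ⟨(Inn k h M).mkQ d, hd⟩ = trHat d hd :=
  trHat_congr α hα _ _ _ _ ((Inn k h M).mkQ_surjective _).choose_spec

/-- `x - α [x]`, as a linear map `g → h`. -/
def complementProj : g →ₗ[k] h where
  toFun x := ⟨x - α (LieSubmodule.Quotient.mk x), by
    rw [← LieSubmodule.Quotient.mk_eq_zero' (N := h)]
    change (LieSubmodule.Quotient.mk x : g ⧸ h) - LieSubmodule.Quotient.mk (α _) = 0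
    rw [hα, sub_self]⟩
  map_add' x y := Subtype.ext (by
    change x + y - α (LieSubmodule.Quotient.mk x + LieSubmodule.Quotient.mk y) =
      (x - α _) + (y - α _)
    rw [map_add]; abel)
  map_smul' t x := Subtype.ext (by
    change t • x - α (t • LieSubmodule.Quotient.mk x) = t • (x - α _)
    rw [map_smul, smul_sub])

theorem complementProj_add (x : g) :
    (complementProj α hα x : g) + α (LieSubmodule.Quotient.mk x) = x := sub_add_cancel _ _

-- Write x = z + α[x] with z in h, and give s(x) the M-component d(z) + η[x]. This lies in the
-- idealizer because z acts on d as δ(d(z)) and α[x] acts on d as δ(η[x]). On h the term η[x]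
-- vanishes, so s restricts to s_d.
include hα in
theorem exists_section_idealizer (d : LieDerivation k h M)
    (hd : (Inn k h M).mkQ d ∈ H1inv k h M) :
    ∃ s : g →ₗ[k] (twistedExt (0 : twoCocycle k g M)).E,
      (∀ x, (twistedExt (0 : twoCocycle k g M)).proj (s x) = x) ∧
      (∀ x, s x ∈ (sd d).idealizer) ∧ ∀ z : h, s z = (sd d).s z := by
  obtain ⟨η, hη⟩ := exists_eta α d hd
  let t : g →ₗ[k] M :=
    d.toLinearMap ∘ₗ complementProj α hα + η ∘ₗ h.toSubmodule.mkQ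
  have ht : ∀ x, t x = d (complementProj α hα x) + η (LieSubmodule.Quotient.mk x) := fun _ ↦ rfl
  let s : g →ₗ[k] (twistedExt (0 : twoCocycle k g M)).E :=
    { toFun := fun x ↦ (⟨(x, t x)⟩ : SemiProd k g M)
      map_add' := fun x y ↦ semiProd_ext rfl (map_add t x y)
      map_smul' := fun a x ↦ semiProd_ext rfl (map_smul t a x) }
  refine ⟨s, fun x ↦ rfl, fun x ↦ (mem_idealizer_sd_iff d _).2 ?_,
    fun z ↦ semiProd_ext rfl ?_⟩
  · change ⁅x, d⁆ = LieDerivation.inner k h M (t x)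
    rw [ht, map_add, ← hη, ← lie_mem_der, ← add_lie, complementProj_add]
  · change t z = d z
    have h0 : (LieSubmodule.Quotient.mk (z : g) : g ⧸ h) = 0 :=
      (LieSubmodule.Quotient.mk_eq_zero' (N := h)).2 z.2
    have h1 : complementProj α hα z = z := Subtype.ext (by
      change (z : g) - α (LieSubmodule.Quotient.mk (z : g)) = z
      rw [h0, map_zero, sub_zero])
    rw [ht, h0, map_zero, add_zero, h1]

/-- A 2-cocycle with values in a Lie submodule, as a 2-cocycle of that submodule. -/
def codRestrictCocycle (N : LieSubmodule k g M) (f : twoCocycle k g M)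
    (hf : ∀ x y, f.1 x y ∈ N) : twoCocycle k g N :=
  ⟨⟨LinearMap.mk₂ k (fun x y ↦ ⟨f.1 x y, hf x y⟩)
    (fun a b c ↦ Subtype.ext (by simp)) (fun t a b ↦ Subtype.ext (by simp))
    (fun a b c ↦ Subtype.ext (by simp)) (fun t a b ↦ Subtype.ext (by simp)),
    fun x ↦ Subtype.ext (f.1.2 x)⟩, by
    rw [mem_twoCocycle_iff]
    ext x y z
    have := (mem_twoCocycle_iff k g M f.1).1 f.2
    exact LinearMap.congr_fun (LinearMap.congr_fun (LinearMap.congr_fun this x) y) z⟩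

/-- The second component of an element of `M ×_f g`. -/
def twistedSnd (f : twoCocycle k g M) : (twistedExt f).E →ₗ[k] M where
  toFun e := LieAlgebra.ofTwoCocycle.carrier e |>.2
  map_add' _ _ := rfl
  map_smul' _ _ := rfl

theorem twistedSnd_lie (a b : (twistedExt (0 : twoCocycle k g M)).E) :
    twistedSnd 0 ⁅a, b⁆ = ⁅(twistedExt (0 : twoCocycle k g M)).proj a, twistedSnd 0 b⁆ -
      ⁅(twistedExt (0 : twoCocycle k g M)).proj b, twistedSnd 0 a⁆ :=
  congrArg (fun m : M ↦ m - ⁅(twistedExt (0 : twoCocycle k g M)).proj b, twistedSnd 0 a⁆)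
    (zero_add ⁅(twistedExt (0 : twoCocycle k g M)).proj a, twistedSnd 0 b⁆)

theorem twistedSnd_incl (f : twoCocycle k g M) (m : M) :
    twistedSnd f ((twistedExt f).incl m) = m := rfl

/-- A linear section with values in the idealizer of `s(h)` defines a 2-cocycle with values in
`M^h`. -/
theorem PartialSplitting.exists_cocycle {X : ModExt.{w} k g M} (S : PartialSplitting h X)
    (s : g →ₗ[k] X.E) (hs : ∀ x, X.proj (s x) = x) (hsI : ∀ x, s x ∈ S.idealizer) :
    ∃ fs : twoCocycle k g (invariants h M),
      ∀ x y, X.incl (fs.1 x y : M) = ⁅s x, s y⁆ - s ⁅x, y⁆ := by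
  -- The idealizer is a subalgebra that meets the image of M exactly in M^h.
  have hmem : ∀ x y, (X.cocycle s hs).1 x y ∈ invariants h M := fun x y ↦ by
    rw [← S.incl_mem_idealizer]
    change X.incl (X.cochain s x y) ∈ S.idealizer
    rw [X.incl_cochain s hs]
    exact sub_mem (S.idealizer.lie_mem (hsI x) (hsI y)) (hsI _)
  exact ⟨codRestrictCocycle (invariants h M) (X.cocycle s hs) hmem, X.incl_cochain s hs⟩

/-- Comparison of the cochain of a section with values in the idealizer with the explicit cochain
on `g / h`, in terms of a splitting `r` of the extension. -/
theorem PartialSplitting.incl_eq_incl_add_defect {X : ModExt.{w} k g M}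
    (S : PartialSplitting h X) (r : X.E →ₗ[k] M) (hr : ∀ m, r (X.incl m) = m)
    (hlie : ∀ a b, r ⁅a, b⁆ = ⁅X.proj a, r b⁆ - ⁅X.proj b, r a⁆)
    (s : g →ₗ[k] X.E) (hs : ∀ x, X.proj (s x) = x) (x y w : g) (z : h)
    (hz : (z : g) = ⁅x, y⁆ - w) (m m' : M) (hm : X.incl m = ⁅s x, s y⁆ - s ⁅x, y⁆)
    (hm' : m' = ⁅x, r (s y)⁆ - ⁅y, r (s x)⁆ - r (s w) - r (S.s z)) :
    X.incl m' = X.incl m + (s z - S.s z) := by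
  -- Everything can be compared in M after applying r. The formula for m' contains r(s w) and that
  -- for m contains r(s[x,y]); their difference is r(s z), since z = [x,y] - w.
  have h0 : X.proj (s z - S.s z) = 0 := by rw [map_sub, hs, S.proj_s, sub_self]
  obtain ⟨v, hv⟩ := (X.exact _).1 h0
  have h1 : v = r (s z) - r (S.s z) := by rw [← map_sub, ← hv, hr]
  have h2 : m = ⁅x, r (s y)⁆ - ⁅y, r (s x)⁆ - r (s ⁅x, y⁆) := by
    rw [← hr m, hm, map_sub, hlie, hs, hs]
  rw [← hv, ← map_add, h1, h2, hz, hm', map_sub s, map_sub r]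
  congr 1
  abel

/-- The M-component of s ∘ α is an admissible η, because s takes values in the idealizer. `trHat_eq`
for this η supplies F, and `incl_eq_incl_add_defect` rewrites it in terms of s. -/
theorem tr_eq_of_section (d : LieDerivation k h M) (hd : (Inn k h M).mkQ d ∈ H1inv k h M)
    (s : g →ₗ[k] (twistedExt (0 : twoCocycle k g M)).E)
    (hs : ∀ x, (twistedExt (0 : twoCocycle k g M)).proj (s x) = x)
    (hsI : ∀ x, s x ∈ (sd d).idealizer) (fs : twoCocycle k g (invariants h M))
    (hfs : ∀ x y,
      (twistedExt (0 : twoCocycle k g M)).incl (fs.1 x y : M) = ⁅s x, s y⁆ - s ⁅x, y⁆) :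
    ∃ F : twoCocycle k (g ⧸ h) (invariants h M),
      (∀ x y, (twistedExt (0 : twoCocycle k g M)).incl (F.1 x y : M) =
        (twistedExt (0 : twoCocycle k g M)).incl (fs.1 (α x) (α y) : M) +
          (s (defect α hα x y : g) - (sd d).s (defect α hα x y))) ∧
      tr ⟨(Inn k h M).mkQ d, hd⟩ = (B2 k (g ⧸ h) (invariants h M)).mkQ F := by
  have hη : ∀ x, ⁅α x, d⁆ = LieDerivation.inner k h M ((twistedSnd 0 ∘ₗ s ∘ₗ α) x) := fun x ↦ by
    have := (mem_idealizer_sd_iff d _).1 (hsI (α x))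
    have h1 : (s (α x)).carrier.1 = α x := hs (α x)
    rw [h1] at this
    exact this
  obtain ⟨F, hF, hF'⟩ := trHat_eq α hα d hd _ hη
  exact ⟨F, fun x y ↦ (sd d).incl_eq_incl_add_defect (twistedSnd 0) (twistedSnd_incl 0)
    twistedSnd_lie s hs _ _ _ _ rfl _ _ (hfs _ _) (hF x y),
    (tr_mk α hα d hd).trans hF'⟩

/-! ### The map ρ: partial splittings as graphs, and explicit derivations. -/

/-- The g-component of S.s(z) is forced to be z, so only the M-component γ is free; compatibility
with brackets is then precisely the condition on γ. -/
theorem PartialSplitting.exists_gamma {f : twoCocycle k g M}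
    (S : PartialSplitting h (twistedExt f)) :
    ∃ (γ : h →ₗ[k] M) (hγ : ∀ z w : h, f.1 z w = γ ⁅z, w⁆ - ⁅z, γ w⁆ + ⁅w, γ z⁆),
      S = twistedSplitting f γ hγ := by
  let sndL : LieAlgebra.ofTwoCocycle f →ₗ[k] M :=
    { toFun := fun e ↦ e.carrier.2, map_add' := fun _ _ ↦ rfl, map_smul' := fun _ _ ↦ rfl }
  let γ : h →ₗ[k] M := sndL ∘ₗ (S.s : h →ₗ[k] (twistedExt f).E)
  have hs : ∀ z, S.s z = (⟨((z : g), γ z)⟩ : LieAlgebra.ofTwoCocycle f) := fun z ↦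
    congrArg LieAlgebra.ofTwoCocycle.mk (Prod.ext (S.proj_s z) rfl)
  have hγ : ∀ z w : h, f.1 z w = γ ⁅z, w⁆ - ⁅z, γ w⁆ + ⁅w, γ z⁆ := fun z w ↦ by
    have h1 := S.s.map_lie z w
    rw [hs, hs, hs] at h1
    have h2 : γ ⁅z, w⁆ = f.1 z w + ⁅z, γ w⁆ - ⁅w, γ z⁆ := congrArg
      (fun e : LieAlgebra.ofTwoCocycle f ↦ e.carrier.2) h1
    rw [h2]; abel
  refine ⟨γ, hγ, ?_⟩
  obtain ⟨s, hs'⟩ := S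
  congr 1
  exact LieHom.ext hs

theorem twistedSplitting_der (f : twoCocycle k g M) (γ : h →ₗ[k] M)
    (hγ : ∀ z w : h, f.1 z w = γ ⁅z, w⁆ - ⁅z, γ w⁆ + ⁅w, γ z⁆) (x : g) (z : h) :
    (twistedSplitting f γ hγ).der (⟨(x, 0)⟩ : LieAlgebra.ofTwoCocycle f) z =
      f.1 x z + ⁅x, γ z⁆ - γ ⁅x, z⁆ := by
  refine (twistedExt f).incl_injective (((twistedSplitting f γ hγ).incl_der _ z).trans ?_)
  refine congrArg LieAlgebra.ofTwoCocycle.mk (Prod.ext (sub_self _) ?_)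
  change f.1 x z + ⁅x, γ z⁆ - ⁅(z : g), (0 : M)⁆ - γ ⁅x, z⁆ = _
  rw [lie_zero, sub_zero]

include hα in
theorem rhoDer_twistedSplitting (f : twoCocycle k g M) (γ : h →ₗ[k] M)
    (hγ : ∀ z w : h, f.1 z w = γ ⁅z, w⁆ - ⁅z, γ w⁆ + ⁅w, γ z⁆) (x : g ⧸ h) :
    (twistedSplitting f γ hγ).rhoDer x = (Inn k h M).mkQ
      ((twistedSplitting f γ hγ).der (⟨(α x, 0)⟩ : LieAlgebra.ofTwoCocycle f)) := by
  have := (twistedSplitting f γ hγ).rhoLin_mk_proj (⟨(α x, 0)⟩ : LieAlgebra.ofTwoCocycle f)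
  rw [← this]
  exact congrArg (twistedSplitting f γ hγ).rhoLin (hα x).symm

include hα in
theorem inner_h1_apply (e : LieDerivation k h M) (x : g ⧸ h) :
    LieDerivation.inner k (g ⧸ h) (H1 k h M) ((Inn k h M).mkQ e) x =
      (Inn k h M).mkQ ⁅α x, e⁆ := by
  rw [← mk_lie_mk, hα]; rfl

-- Covers the change of cocycle and the change of splitting together. If f' - f is the coboundary of
-- c, the difference of the conditions on γ' and γ says that e = γ' - γ + c|_h is a derivation.
-- Letting α(x) act on e gives D'_x - D_x + δ(c(α(x))), so the two derivations into H¹(h, M) differ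
-- by the inner derivation of [e].
include hα in
theorem rhoHat_congr {f f' : twoCocycle k g M} (hff : (B2 k g M).mkQ f' = (B2 k g M).mkQ f)
    (S : PartialSplitting h (twistedExt f)) (S' : PartialSplitting h (twistedExt f')) :
    rhoHat S' = rhoHat S := by
  obtain ⟨γ, hγ, rfl⟩ := S.exists_gamma
  obtain ⟨γ', hγ', rfl⟩ := S'.exists_gamma
  obtain ⟨c, hc⟩ := (Submodule.Quotient.eq _).1 hff
  have hc' : ∀ x y, ⁅x, c y⁆ - ⁅y, c x⁆ - c ⁅x, y⁆ = f'.1 x y - f.1 x y := fun x y ↦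
    LinearMap.congr_fun (LinearMap.congr_fun (congrArg Subtype.val hc) x) y
  let e : LieDerivation k h M :=
    { γ' - γ + c ∘ₗ h.toSubmodule.subtype with
      leibniz' := fun z w ↦ by
        change γ' ⁅z, w⁆ - γ ⁅z, w⁆ + c ⁅(z : g), (w : g)⁆ =
          ⁅z, γ' w - γ w + c w⁆ - ⁅w, γ' z - γ z + c z⁆
        have h1 := hc' z w
        rw [hγ, hγ'] at h1
        have h2 : ∀ (z : h) (m : M), ⁅z, m⁆ = ⁅(z : g), m⁆ := fun _ _ ↦ rfl
        simp only [h2, lie_add, lie_sub] at h1 ⊢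
        rw [← sub_eq_zero] at h1 ⊢
        rw [← neg_eq_zero, ← h1]
        abel }
  have he : ∀ z : h, e z = γ' z - γ z + c z := fun _ ↦ rfl
  refine (Submodule.Quotient.eq _).2 ⟨(Inn k h M).mkQ e, LieDerivation.ext fun x ↦ ?_⟩
  rw [LieDerivation.sub_apply, rhoDer_twistedSplitting α hα, rhoDer_twistedSplitting α hα,
    ← map_sub]
  refine (inner_h1_apply α hα e x).trans ((Submodule.Quotient.eq _).2 ⟨c (α x), LieDerivation.ext fun z ↦ ?_⟩)
  simp only [LieDerivation.sub_apply, twistedSplitting_der, der_lie_apply, he]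
  change ⁅(z : g), c (α x)⁆ = ⁅α x, γ' z - γ z + c z⁆ -
    (γ' ⁅α x, z⁆ - γ ⁅α x, z⁆ + c ⁅α x, (z : g)⁆) - _
  have h2 := hc' (α x) z
  rw [← sub_eq_zero, ← sub_eq_zero.2 h2.symm]
  simp only [lie_add, lie_sub]
  abel

include hα in
theorem rho_mk (f : twoCocycle k g M) (hf : (B2 k g M).mkQ f ∈ H2one k h M)
    (S : PartialSplitting h (twistedExt f)) : rho ⟨(B2 k g M).mkQ f, hf⟩ = rhoHat S :=
  rhoHat_congr α hα ((B2 k g M).mkQ_surjective _).choose_spec _ _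

end TrRho

/-! ### The map λ: explicit 3-cocycles. -/

section Lambda

variable {k : Type*} [Field k] {g : Type*} [LieRing g] [LieAlgebra k g] {h : LieIdeal k g}
variable {M : Type*} [AddCommGroup M] [Module k M] [LieRingModule g M] [LieModule k g M]
variable (α : (g ⧸ h) →ₗ[k] g) (hα : ∀ x, (LieSubmodule.Quotient.mk (α x) : g ⧸ h) = x)

/-- `defect` as an alternating bilinear map. -/
def defectCochain : twoCochain k (g ⧸ h) h :=
  ⟨LinearMap.mk₂ k (defect α hα)
    (fun a b c ↦ Subtype.ext (by
      change ⁅α (a + b), α c⁆ - α ⁅a + b, c⁆ = (⁅α a, α c⁆ - α ⁅a, c⁆) + (⁅α b, α c⁆ - α ⁅b, c⁆)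
      simp only [map_add, add_lie]; abel))
    (fun t a b ↦ Subtype.ext (by
      change ⁅α (t • a), α b⁆ - α ⁅t • a, b⁆ = t • (⁅α a, α b⁆ - α ⁅a, b⁆)
      simp only [map_smul, smul_lie, smul_sub]))
    (fun a b c ↦ Subtype.ext (by
      change ⁅α a, α (b + c)⁆ - α ⁅a, b + c⁆ = (⁅α a, α b⁆ - α ⁅a, b⁆) + (⁅α a, α c⁆ - α ⁅a, c⁆)
      simp only [map_add, lie_add]; abel))
    (fun t a b ↦ Subtype.ext (by
      change ⁅α a, α (t • b)⁆ - α ⁅a, t • b⁆ = t • (⁅α a, α b⁆ - α ⁅a, b⁆)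
      simp only [map_smul, lie_smul, smul_sub])),
    fun x ↦ Subtype.ext (by
      change ⁅α x, α x⁆ - α ⁅x, x⁆ = 0
      rw [lie_self, lie_self, map_zero, sub_zero])⟩

/-- The Bianchi identity for `defect`. -/
theorem defect_bianchi (x y z : g ⧸ h) :
    ⁅α x, defect α hα y z⁆ - ⁅α y, defect α hα x z⁆ + ⁅α z, defect α hα x y⁆
      - defect α hα ⁅x, y⁆ z + defect α hα ⁅x, z⁆ y - defect α hα ⁅y, z⁆ x = 0 := by
  refine Subtype.ext ?_
  change ⁅α x, ⁅α y, α z⁆ - α ⁅y, z⁆⁆ - ⁅α y, ⁅α x, α z⁆ - α ⁅x, z⁆⁆ + ⁅α z, ⁅α x, α y⁆ - α ⁅x, y⁆⁆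
    - (⁅α ⁅x, y⁆, α z⁆ - α ⁅⁅x, y⁆, z⁆) + (⁅α ⁅x, z⁆, α y⁆ - α ⁅⁅x, z⁆, y⁆)
    - (⁅α ⁅y, z⁆, α x⁆ - α ⁅⁅y, z⁆, x⁆) = 0
  have e1 : ⁅⁅x, y⁆, z⁆ = ⁅x, ⁅y, z⁆⁆ - ⁅y, ⁅x, z⁆⁆ := lie_lie x y z
  have e2 : ⁅⁅x, z⁆, y⁆ = - ⁅y, ⁅x, z⁆⁆ := (lie_skew _ _).symm
  have e3 : ⁅⁅y, z⁆, x⁆ = - ⁅x, ⁅y, z⁆⁆ := (lie_skew _ _).symm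
  have a1 : ⁅α z, ⁅α x, α y⁆⁆ = - (⁅α x, ⁅α y, α z⁆⁆ - ⁅α y, ⁅α x, α z⁆⁆) := by
    rw [← lie_lie, lie_skew]
  rw [← lie_skew (α ⁅x, y⁆), ← lie_skew (α ⁅x, z⁆), ← lie_skew (α ⁅y, z⁆)]
  simp only [lie_sub, e1, e2, e3, a1, map_sub, map_neg]
  abel

variable (D : LieDerivation k (g ⧸ h) (H1 k h M)) (r : (g ⧸ h) →ₗ[k] LieDerivation k h M)

/-- The alternating bilinear map `(x, y) ↦ ^{α x} r y - ^{α y} r x - r [x, y]`. -/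
def derCochain : twoCochain k (g ⧸ h) (LieDerivation k h M) :=
  ⟨LinearMap.mk₂ k (fun x y ↦ ⁅α x, r y⁆ - ⁅α y, r x⁆ - r ⁅x, y⁆)
    (fun a b c ↦ by simp only [map_add, lie_add, add_lie]; abel)
    (fun t a b ↦ by simp only [map_smul, lie_smul, smul_lie, smul_sub])
    (fun a b c ↦ by simp only [map_add, lie_add, add_lie]; abel)
    (fun t a b ↦ by simp only [map_smul, lie_smul, smul_lie, smul_sub]),
    fun x ↦ by
      change ⁅α x, r x⁆ - ⁅α x, r x⁆ - r ⁅x, x⁆ = 0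
      rw [lie_self, map_zero, sub_self, sub_zero]⟩

-- Modulo inner derivations the cochain becomes x·D(y) - y·D(x) - D[x,y], which vanishes because D
-- is a derivation. The lift r of D is arbitrary, not of the form s ∘ D for a fixed section s:
-- changing D by an inner derivation requires a correspondingly shifted lift.
include hα in
theorem derCochain_mem_inn (hr : ∀ x, (Inn k h M).mkQ (r x) = D x) (x y : g ⧸ h) :
    derCochain α r x y ∈ Inn k h M := by
  have h1 : ∀ x y, ⁅x, D y⁆ = (Inn k h M).mkQ ⁅α x, r y⁆ := fun x y ↦ by
    rw [← mk_lie_mk, hα, hr]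
  refine (Submodule.Quotient.mk_eq_zero _).1 ?_
  change (Inn k h M).mkQ (⁅α x, r y⁆ - ⁅α y, r x⁆ - r ⁅x, y⁆) = 0
  rw [map_sub, map_sub, ← h1, ← h1, hr, LieDerivation.apply_lie_eq_sub, sub_self]

include hα in
theorem exists_inner_cochain (hr : ∀ x, (Inn k h M).mkQ (r x) = D x) :
    ∃ F : twoCochain k (g ⧸ h) M, ∀ x y, LieDerivation.inner k h M (F x y) =
      ⁅α x, r y⁆ - ⁅α y, r x⁆ - r ⁅x, y⁆ := by
  obtain ⟨t, ht⟩ := exists_quasiInverse (LieDerivation.inner k h M)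
  refine ⟨⟨(derCochain α r).1.compr₂ t, fun x ↦ ?_⟩, fun x y ↦ ?_⟩
  · change t (derCochain α r x x) = 0
    rw [twoCochain_alt, map_zero]
  · change LieDerivation.inner k h M (t (derCochain α r x y)) = derCochain α r x y
    refine (derCochain_mem_inn α hα D r hr x y).elim fun m hm ↦ ?_
    rw [← hm, ht]

variable (hr : ∀ x, (Inn k h M).mkQ (r x) = D x) (F : twoCochain k (g ⧸ h) M)
  (hF : ∀ x y, LieDerivation.inner k h M (F x y) = ⁅α x, r y⁆ - ⁅α y, r x⁆ - r ⁅x, y⁆)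

/-- The section `x ↦ (α x, r x)` of `pairs D → g / h`. -/
def pairsSection : (g ⧸ h) →ₗ[k] pairs D where
  toFun x := ⟨⟨(α x, r x)⟩, mem_pairs D (α x) (r x) (by rw [hα, hr])⟩
  map_add' x y := Subtype.ext (semiProd_ext (map_add α x y) (map_add r x y))
  map_smul' t x := Subtype.ext (semiProd_ext (map_smul α t x) (map_smul r t x))

/-- The alternating bilinear map `(x, y) ↦ (f_α(x, y), -F(x, y))` with values in `M ⋊ h`. -/
def semiProdCochain : twoCochain k (g ⧸ h) (SemiProd k h M) :=
  ⟨LinearMap.mk₂ k (fun x y ↦ ⟨(defectCochain α hα x y, (-F) x y)⟩)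
    (fun a b c ↦ semiProd_ext (LinearMap.map_add₂ (defectCochain α hα).1 a b c)
      (LinearMap.map_add₂ (-F).1 a b c))
    (fun t a b ↦ semiProd_ext (LinearMap.map_smul₂ (defectCochain α hα).1 t a b)
      (LinearMap.map_smul₂ (-F).1 t a b))
    (fun a b c ↦ semiProd_ext (map_add (defectCochain α hα a) b c) (map_add ((-F) a) b c))
    (fun t a b ↦ semiProd_ext (map_smul (defectCochain α hα a) t b) (map_smul ((-F) a) t b)),
    fun x ↦ semiProd_ext ((defectCochain α hα).2 x) ((-F).2 x)⟩

/-- The choices given by `α`, `r` and `F` for the crossed extension `crossedOf D`. -/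
def crossedChoice : (crossedOf D).Choice where
  sec := pairsSection α hα D r hr
  proj_sec := hα
  lift := semiProdCochain α hα F
  bnd_lift x y := by
    refine Subtype.ext ?_
    refine Eq.trans ?_ (congrArg (· - (⟨(α ⁅x, y⁆, r ⁅x, y⁆)⟩ :
      SemiProd k g (LieDerivation k h M))) (semiProd_lie ⟨(α x, r x)⟩ ⟨(α y, r y)⟩)).symm
    refine semiProd_ext rfl ?_
    -- The sign of F in the lift compensates for the sign in the middle map (m, z) ↦ (-δ(m), z).
    change -LieDerivation.inner k h M (-F x y) = ⁅α x, r y⁆ - ⁅α y, r x⁆ - r ⁅x, y⁆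
    rw [map_neg, neg_neg, hF]

include hα hr hF in
/-- The class `lamHat D` is represented by an explicit cocycle. -/
theorem lamHat_eq :
    ∃ c : threeCocycle k (g ⧸ h) (invariants h M),
      (∀ x y z, (c.1.1 x y z : M) =
        -(⁅α x, F y z⁆ - ⁅α y, F x z⁆ + ⁅α z, F x y⁆
          - F ⁅x, y⁆ z + F ⁅x, z⁆ y - F ⁅y, z⁆ x)
        + r x (defect α hα y z) - r y (defect α hα x z) + r z (defect α hα x y)) ∧
      lamHat D = (B3 k (g ⧸ h) (invariants h M)).mkQ c := by
  let C := crossedChoice α hα D r hr F hF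
  refine ⟨C.cocycle, fun x y z ↦ ?_, CrossedExt.cls_eq C⟩
  -- Only the M-component is needed. There (r(x), α(x)) sends (-F(y,z), f_α(y,z)) to -α(x)·F(y,z) +
  -- r(x)(f_α(y,z)), which accounts for both kinds of terms in c.
  have h1 := congrArg (fun e : SemiProd k h M ↦ e.carrier.2) (C.incl_cochain x y z)
  refine h1.trans ?_
  change (⁅α x, -F y z⁆ + r x (defect α hα y z)) - (⁅α y, -F x z⁆ + r y (defect α hα x z))
    + (⁅α z, -F x y⁆ + r z (defect α hα x y)) - -F ⁅x, y⁆ z + -F ⁅x, z⁆ y - -F ⁅y, z⁆ x = _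
  simp only [lie_neg]
  abel

/-- The linear map `x ↦ r x + ^{α x} e`. -/
def addInner (e : LieDerivation k h M) : (g ⧸ h) →ₗ[k] LieDerivation k h M :=
  r + (LieModule.toEnd k g (LieDerivation k h M) :
    g →ₗ[k] Module.End k (LieDerivation k h M)).flip e ∘ₗ α

theorem addInner_apply (e : LieDerivation k h M) (x : g ⧸ h) :
    addInner α r e x = r x + ⁅α x, e⁆ := rfl

/-- The cochain `(x, y) ↦ F x y + e (f_α (x, y))`. -/
def addDefect (e : LieDerivation k h M) : twoCochain k (g ⧸ h) M :=
  F + ⟨(defectCochain α hα).1.compr₂ e.toLinearMap, fun x ↦ by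
    change e (defectCochain α hα x x) = 0
    rw [twoCochain_alt, map_zero]⟩

theorem addDefect_apply (e : LieDerivation k h M) (x y : g ⧸ h) :
    addDefect α hα F e x y = F x y + e (defect α hα x y) := rfl

-- The added terms are the action on e of [α(x), α(y)] - α[x,y] = f_α(x, y), an element of h. By
-- `lie_mem_der` it acts on e as δ(e(f_α(x, y))), which is what adding e ∘ f_α to F contributes.
include hF in
theorem inner_addDefect (e : LieDerivation k h M) (x y : g ⧸ h) :
    LieDerivation.inner k h M (addDefect α hα F e x y) =
      ⁅α x, addInner α r e y⁆ - ⁅α y, addInner α r e x⁆ - addInner α r e ⁅x, y⁆ := by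
  have h1 : ((defect α hα x y : h) : g) = ⁅α x, α y⁆ - α ⁅x, y⁆ := rfl
  rw [addDefect_apply, map_add, hF, ← lie_mem_der, h1, addInner_apply, addInner_apply,
    addInner_apply]
  simp only [lie_add, sub_lie, lie_lie]
  abel

/-- The terms α(x)·e(f_α(y, z)) coming from F and from r cancel. What remains is minus e applied to
the left side of `defect_bianchi`, hence zero. -/
theorem addDefect_cochain_eq (e : LieDerivation k h M) (x y z : g ⧸ h) :
    -(⁅α x, addDefect α hα F e y z⁆ - ⁅α y, addDefect α hα F e x z⁆
      + ⁅α z, addDefect α hα F e x y⁆ - addDefect α hα F e ⁅x, y⁆ z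
      + addDefect α hα F e ⁅x, z⁆ y - addDefect α hα F e ⁅y, z⁆ x)
    + addInner α r e x (defect α hα y z) - addInner α r e y (defect α hα x z)
    + addInner α r e z (defect α hα x y) =
      -(⁅α x, F y z⁆ - ⁅α y, F x z⁆ + ⁅α z, F x y⁆ - F ⁅x, y⁆ z + F ⁅x, z⁆ y - F ⁅y, z⁆ x)
      + r x (defect α hα y z) - r y (defect α hα x z) + r z (defect α hα x y) := by
  have h1 := congrArg e (defect_bianchi α hα x y z)
  simp only [map_sub, map_add, map_zero] at h1
  simp only [addInner_apply, addDefect_apply, LieDerivation.add_apply, der_lie_apply, lie_add]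
  rw [← sub_eq_zero, ← neg_eq_zero, ← h1]
  abel

include hα hr hF in
theorem lamHat_eq_of_add (D' : LieDerivation k (g ⧸ h) (H1 k h M)) (e : LieDerivation k h M)
    (hD : ∀ x, D' x = D x + (Inn k h M).mkQ ⁅α x, e⁆) : lamHat D' = lamHat D := by
  refine (lamHat_eq α hα D r hr F hF).elim fun c hc ↦
    (lamHat_eq α hα D' (addInner α r e) (fun x ↦ ?_) (addDefect α hα F e)
      (inner_addDefect α hα r F hF e)).elim fun b hb ↦
        hb.2.trans ((congrArg _ ?_).trans hc.2.symm)
  · rw [addInner_apply, map_add, hr, hD]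
  · exact Subtype.ext (Subtype.ext (LinearMap.ext fun x ↦ LinearMap.ext fun y ↦
      LinearMap.ext fun z ↦ Subtype.ext ((hb.1 x y z).trans
        ((addDefect_cochain_eq α hα r F e x y z).trans (hc.1 x y z).symm))))

-- If D' - D is the inner derivation of ξ and e represents ξ, then D'(x) - D(x) is the class of α(x)
-- acting on e, which is the situation of `lamHat_eq_of_add`.
include hα in
theorem lamHat_congr {D D' : LieDerivation k (g ⧸ h) (H1 k h M)}
    (hD : (Inn k (g ⧸ h) (H1 k h M)).mkQ D' = (Inn k (g ⧸ h) (H1 k h M)).mkQ D) :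
    lamHat D' = lamHat D := by
  refine ((Submodule.Quotient.eq _).1 hD).elim fun ξ hξ ↦
    ((Inn k h M).mkQ_surjective ξ).elim fun e he ↦
    (LinearMap.exists_rightInverse_of_surjective (Inn k h M).mkQ
      (LinearMap.range_eq_top.2 (Inn k h M).mkQ_surjective)).elim fun s hs ↦ ?_
  have hr : ∀ x, (Inn k h M).mkQ ((s ∘ₗ D.toLinearMap) x) = D x := fun x ↦
    LinearMap.congr_fun hs (D x)
  refine (exists_inner_cochain α hα D _ hr).elim fun F hF ↦
    lamHat_eq_of_add α hα D _ hr F hF D' e fun x ↦ ?_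
  rw [← inner_h1_apply α hα, he, hξ, LieDerivation.sub_apply, add_sub_cancel]

include hα in
theorem lam_mk : lam ((Inn k (g ⧸ h) (H1 k h M)).mkQ D) = lamHat D :=
  lamHat_congr α hα ((Inn k (g ⧸ h) (H1 k h M)).mkQ_surjective _).choose_spec

end Lambda

end LieSeq

/-! ### Explicit representatives of tr, ρ and λ. -/

theorem mainTheorem12 {k : Type*} [Field k] {g : Type*} [LieRing g] [LieAlgebra k g]
    (h : LieIdeal k g) (M : Type*) [AddCommGroup M] [Module k M] [LieRingModule g M]
    [LieModule k g M] (α : (g ⧸ h) →ₗ[k] g)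
    (hα : ∀ x, (LieSubmodule.Quotient.mk (α x) : g ⧸ h) = x) :
    -- the class `tr [d]`, described through a section with values in the idealizer
    (∀ (d : LieDerivation k h M)
      (hd : (Inn k h M).mkQ d ∈ LieModule.maxTrivSubmodule k (g ⧸ h) (H1 k h M)),
      tr ⟨(Inn k h M).mkQ d, hd⟩ = trHat d hd ∧
      (∃ s : g →ₗ[k] (twistedExt (0 : twoCocycle k g M)).E,
        (∀ x, (twistedExt (0 : twoCocycle k g M)).proj (s x) = x) ∧
        (∀ x, s x ∈ (sd d).idealizer) ∧ ∀ z : h, s z = (sd d).s z) ∧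
      (∀ s : g →ₗ[k] (twistedExt (0 : twoCocycle k g M)).E,
        (∀ x, (twistedExt (0 : twoCocycle k g M)).proj (s x) = x) →
        (∀ x, s x ∈ (sd d).idealizer) →
        ∃ (fs : twoCocycle k g (invariants h M))
          (F : twoCocycle k (g ⧸ h) (invariants h M)),
          (∀ x y, (twistedExt (0 : twoCocycle k g M)).incl (fs.1 x y : M) = ⁅s x, s y⁆ - s ⁅x, y⁆) ∧
          (∀ x y, (twistedExt (0 : twoCocycle k g M)).incl (F.1 x y : M) =
            (twistedExt (0 : twoCocycle k g M)).incl (fs.1 (α x) (α y) : M) +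
              (s (defect α hα x y : g) - (sd d).s (defect α hα x y))) ∧
          ((∀ z : h, s z = (sd d).s z) → ∀ x y, F.1 x y = fs.1 (α x) (α y)) ∧
          tr ⟨(Inn k h M).mkQ d, hd⟩ = (B2 k (g ⧸ h) (invariants h M)).mkQ F)) ∧
    -- the class `tr [d]`, given by an explicit formula
    (∀ (d : LieDerivation k h M)
      (hd : (Inn k h M).mkQ d ∈ LieModule.maxTrivSubmodule k (g ⧸ h) (H1 k h M)),
      (∃ η : (g ⧸ h) →ₗ[k] M, ∀ x, ⁅α x, d⁆ = LieDerivation.inner k h M (η x)) ∧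
      ∀ η : (g ⧸ h) →ₗ[k] M, (∀ x, ⁅α x, d⁆ = LieDerivation.inner k h M (η x)) →
        ∃ F : twoCocycle k (g ⧸ h) (invariants h M),
          (∀ x y, (F.1 x y : M) =
            ⁅α x, η y⁆ - ⁅α y, η x⁆ - η ⁅x, y⁆ - d (defect α hα x y)) ∧
          tr ⟨(Inn k h M).mkQ d, hd⟩ = (B2 k (g ⧸ h) (invariants h M)).mkQ F) ∧
    -- the class `ρ [f]`
    (∀ (f : twoCocycle k g M) (hf : (B2 k g M).mkQ f ∈ H2one k h M),
      (∀ S : PartialSplitting h (twistedExt f), rho ⟨(B2 k g M).mkQ f, hf⟩ = rhoHat S) ∧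
      (∃ γ : h →ₗ[k] M, ∀ z w : h,
        f.1 (z : g) (w : g) = γ ⁅z, w⁆ - ⁅(z : g), γ w⁆ + ⁅(w : g), γ z⁆) ∧
      ∀ γ : h →ₗ[k] M,
        (∀ z w : h, f.1 (z : g) (w : g) = γ ⁅z, w⁆ - ⁅(z : g), γ w⁆ + ⁅(w : g), γ z⁆) →
        ∃ D : LieDerivation k (g ⧸ h) (H1 k h M),
          (∀ x, ∃ Dx : LieDerivation k h M,
            (∀ z : h, Dx z = f.1 (α x) (z : g) + ⁅α x, γ z⁆ - γ ⁅α x, z⁆) ∧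
            D x = (Inn k h M).mkQ Dx) ∧
          rho ⟨(B2 k g M).mkQ f, hf⟩ = (Inn k (g ⧸ h) (H1 k h M)).mkQ D) ∧
    -- the class `λ [D]`
    (∀ s : H1 k h M →ₗ[k] LieDerivation k h M, (∀ ξ, (Inn k h M).mkQ (s ξ) = ξ) →
      ∀ D : LieDerivation k (g ⧸ h) (H1 k h M),
        lam ((Inn k (g ⧸ h) (H1 k h M)).mkQ D) = lamHat D ∧
        (∃ F : twoCochain k (g ⧸ h) M, ∀ x y, LieDerivation.inner k h M (F x y) =
          ⁅α x, s (D y)⁆ - ⁅α y, s (D x)⁆ - s (D ⁅x, y⁆)) ∧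
        ∀ F : twoCochain k (g ⧸ h) M,
          (∀ x y, LieDerivation.inner k h M (F x y) =
            ⁅α x, s (D y)⁆ - ⁅α y, s (D x)⁆ - s (D ⁅x, y⁆)) →
          ∃ c : threeCocycle k (g ⧸ h) (invariants h M),
            (∀ x y z, (c.1.1 x y z : M) =
              -(⁅α x, F y z⁆ - ⁅α y, F x z⁆ + ⁅α z, F x y⁆
                - F ⁅x, y⁆ z + F ⁅x, z⁆ y - F ⁅y, z⁆ x)
              + s (D x) (defect α hα y z) - s (D y) (defect α hα x z)
              + s (D z) (defect α hα x y)) ∧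
            lam ((Inn k (g ⧸ h) (H1 k h M)).mkQ D) = (B3 k (g ⧸ h) (invariants h M)).mkQ c) := by
  refine ⟨fun d hd ↦ ⟨tr_mk α hα d hd, exists_section_idealizer α hα d hd, fun s hs hsI ↦ ?_⟩,
    fun d hd ↦ ⟨exists_eta α d hd, fun η hη ↦ ?_⟩,
    fun f hf ↦ ⟨rho_mk α hα f hf, ?_, fun γ hγ ↦ ?_⟩,
    fun s hs D ↦ ⟨lam_mk α hα D, ?_, fun F hF ↦ ?_⟩⟩
  · refine ((sd d).exists_cocycle s hs hsI).elim fun fs hfs ↦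
      (tr_eq_of_section α hα d hd s hs hsI fs hfs).elim fun F hF ↦
        ⟨fs, F, hfs, hF.1, fun hext x y ↦ Subtype.ext
          ((twistedExt (0 : twoCocycle k g M)).incl_injective ((hF.1 x y).trans ?_)), hF.2⟩
    rw [hext, sub_self, add_zero]
  · obtain ⟨F, hF, hF'⟩ := trHat_eq α hα d hd η hη
    exact ⟨F, hF, (tr_mk α hα d hd).trans hF'⟩
  · obtain ⟨S⟩ := exists_partialSplitting f hf
    obtain ⟨γ, hγ, -⟩ := S.exists_gamma
    exact ⟨γ, hγ⟩
  · exact ⟨(twistedSplitting f γ hγ).rhoDer,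
      fun x ↦ ⟨_, twistedSplitting_der f γ hγ (α x), rhoDer_twistedSplitting α hα f γ hγ x⟩,
      rho_mk α hα f hf _⟩
  -- The lift r is specialized to s ∘ D.
  · exact exists_inner_cochain α hα D (s ∘ₗ D.toLinearMap) fun x ↦ hs (D x)
  · exact (lamHat_eq α hα D (s ∘ₗ D.toLinearMap) (fun x ↦ hs (D x)) F hF).imp fun c hc ↦
      ⟨hc.1, (lam_mk α hα D).trans hc.2⟩
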